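/- Let $d \ge 2$ be a fixed integer and let $X^{(1)}, X^{(2)}, \dots$ be independent, identically distributed random vectors in $\mathbb{R}^d$, each having independent Exponential$(1)$ coordinates. For $1 \le k \le n$, call $X^{(k)}$ a current record at time $n$ if there is no $i \in \{1, \dots, n\}$ with $X^{(k)}_j < X^{(i)}_j$ for every $j = 1, \dots, d$. For $n \ge 1$ let $\hat F_n^-$ be the minimum of the coordinate-sums $X^{(k)}_1 + \cdots + X^{(k)}_d$ over all current records $X^{(k)}$ at time $n$. Write $\ln_k$ for the $k$-th iterate of the natural logarithm. Then: (a) $\hat F_n^- = \ln n - \ln_3 n - \ln(d-1) + O_p\!\left(\frac{1}{\ln_2 n}\right)$ as $n \to \infty$; that is, for every $\varepsilon > 0$ there is a constant $M$ such that, for all sufficiently large $n$, $$\mathbb{P}\left( \left| \hat F_n^- - [\ln n - \ln_3 n - \ln(d-1)] \right| > \frac{M}{\ln_2 n} \right) \le \varepsilon .$$ (b) If $d \ge 3$, then for every $c > 0$, $$\mathbb{P}\left( \hat F_n^- \ge \ln n - \ln_3 n - \ln(d-2) + \ln 2 + c \ \text{ for infinitely many } n \right) = 0 .$$ (c) For every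 $c > 0$, $$\mathbb{P}\left( \hat F_n^- \le \ln n - \ln_3 n - \ln d - \ln 2 - c \ \text{ for infinitely many } n \right) = 0 .$$ -/

import Mathlib

open MeasureTheory ProbabilityTheory Filter

/-- `IsCurrentRecord x n k`: among the first `n` points `x 0, …, x (n - 1)` of a sequence in `ℝ^d`,
the point `x k` is a current (remaining) Pareto record, that is, `k < n` and no `x i` with `i < n`
is strictly larger than `x k` in every coordinate. -/
def IsCurrentRecord {d : ℕ} (x : ℕ → Fin d → ℝ) (n k : ℕ) : Prop :=
  k < n ∧ ∀ i < n, ¬ ∀ j, x k j < x i j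

/-- The minimum coordinate-sum of the current records among the first `n` points.  The minimum is
attained as soon as `1 ≤ n` and `1 ≤ d`, see `isLeast_minRecordSum`. -/
noncomputable def minRecordSum {d : ℕ} (x : ℕ → Fin d → ℝ) (n : ℕ) : ℝ :=
  sInf {s | ∃ k, IsCurrentRecord x n k ∧ s = ∑ j, x k j}

theorem isLeast_minRecordSum {d : ℕ} (hd : 1 ≤ d) (x : ℕ → Fin d → ℝ) {n : ℕ} (hn : 1 ≤ n) :
    IsLeast {s | ∃ k, IsCurrentRecord x n k ∧ s = ∑ j, x k j} (minRecordSum x n) := by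
  have hfin : {s | ∃ k, IsCurrentRecord x n k ∧ s = ∑ j, x k j}.Finite := by
    refine ((Set.finite_Iio n).image (fun k => ∑ j, x k j)).subset ?_
    rintro s ⟨k, hk, rfl⟩
    exact ⟨k, hk.1, rfl⟩
  have hne : {s | ∃ k, IsCurrentRecord x n k ∧ s = ∑ j, x k j}.Nonempty := by
    obtain ⟨k, hk, hmax⟩ := Finset.exists_max_image (Finset.range n) (fun k => x k ⟨0, hd⟩)
      ⟨0, Finset.mem_range.2 hn⟩
    refine ⟨_, k, ⟨Finset.mem_range.1 hk, fun i hi h => ?_⟩, rfl⟩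
    exact absurd (h ⟨0, hd⟩) (not_lt.2 (hmax i (Finset.mem_range.2 hi)))
  exact ⟨hne.csInf_mem hfin, fun s hs => csInf_le hfin.bddBelow hs⟩

/-- `Y n = O_p (a n)` as `n → ∞`: for every `ε > 0` there is a constant `M` such that
`P (|Y n| > M |a n|) ≤ ε` for all large `n`. -/
def IsBigOInProb {Ω : Type*} [MeasurableSpace Ω] (P : Measure Ω) (Y : ℕ → Ω → ℝ) (a : ℕ → ℝ) :
    Prop :=
  ∀ ε : ℝ, 0 < ε → ∃ M : ℝ, ∀ᶠ n in atTop, P {ω | M * |a n| < |Y n ω|} ≤ ENNReal.ofReal ε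

/-! Put d = D + 1. The minimum is at most b exactly when some undominated point has coordinate-sum
at most b. A given point exceeds a point of sum s in every coordinate with probability e^{-s}, so
the expected number of undominated points of sum at most b is bounded by roughly b^D exp(-n e^{-b}).
For b near ln n this is of order one when n e^{-b} = D ln ln n, that is, b = ln n - ln_3 n - ln D.

Lower bounds for the minimum come from this first moment (`measure_exists_undominated_le`). Upper
bounds come from a second moment (`measureReal_not_exists_undominated_le`): put a grid on the
simplex of sum b and count pairs (g, i) such that X i lies in a small box at g and is alone in the
orthant above g. Such a point is undominated. The emptiness of two orthants is nearly independent
once their corners are far apart, so only nearby pairs inflate the variance.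

For (a), both bounds are used at time n with ln ln n shifted by ±M; the failure probabilities are
O(e^{-M}) + o(1). For (b) and (c), a dyadic block 2^k ≤ n < 2^(k+1) is replaced by its two end
times, which costs ln 2, and Borel–Cantelli is applied over k. Up to logarithms the main failure
terms are k^(g-D) in (b) and k^(D-(D+1)e^c) in (c). Summability asks for exponents below -1, which
turns D into D - 1 = d - 2 and D + 1 = d respectively. -/

/-! ### The standard exponential law -/

instance isProbabilityMeasure_expMeasure_one : IsProbabilityMeasure (expMeasure 1) :=
  isProbabilityMeasure_expMeasure one_pos

theorem lintegral_expMeasure_one (f : ℝ → ENNReal) (hf : Measurable f) :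
    ∫⁻ x, f x ∂expMeasure 1 = ∫⁻ x in Set.Ici 0, ENNReal.ofReal (Real.exp (-x)) * f x := by
  have h1 : expMeasure 1 = volume.withDensity (exponentialPDF 1) := rfl
  have hm : Measurable (exponentialPDF 1) :=
    (measurable_exponentialPDFReal 1).ennreal_ofReal
  rw [h1, lintegral_withDensity_eq_lintegral_mul _ hm hf, ← lintegral_indicator measurableSet_Ici]
  congr 1 with x
  by_cases hx : 0 ≤ x
  · simp [exponentialPDF_eq, hx]
  · simp [exponentialPDF_eq, hx]

theorem expMeasure_one_real_Ioi {a : ℝ} (ha : 0 ≤ a) :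
    (expMeasure 1).real (Set.Ioi a) = Real.exp (-a) := by
  have h := cdf_expMeasure_eq one_pos a
  rw [cdf_eq_real, if_pos ha, one_mul] at h
  rw [← Set.compl_Iic, probReal_compl_eq_one_sub measurableSet_Iic, h]
  ring

theorem expMeasure_one_singleton (a : ℝ) : expMeasure 1 {a} = 0 := by
  have h1 : expMeasure 1 = volume.withDensity (exponentialPDF 1) := rfl
  rw [h1]
  exact withDensity_absolutelyContinuous _ _ Real.volume_singleton

theorem expMeasure_one_real_Ici {a : ℝ} (ha : 0 ≤ a) :
    (expMeasure 1).real (Set.Ici a) = Real.exp (-a) := by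
  rw [← expMeasure_one_real_Ioi ha]
  have : NullSingletonClass (expMeasure 1) := ⟨expMeasure_one_singleton⟩
  exact measureReal_congr Ioi_ae_eq_Ici.symm

theorem expMeasure_one_real_Ico {a h : ℝ} (ha : 0 ≤ a) (hh : 0 ≤ h) :
    (expMeasure 1).real (Set.Ico a (a + h)) = Real.exp (-a) * (1 - Real.exp (-h)) := by
  rw [← Set.Ici_sdiff_Ici, measureReal_sdiff (Set.Ici_subset_Ici.2 (by linarith)) measurableSet_Ici,
    expMeasure_one_real_Ici ha, expMeasure_one_real_Ici (by linarith), neg_add, Real.exp_add]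
  ring

theorem ae_nonneg_expMeasure_one : ∀ᵐ x ∂expMeasure 1, 0 ≤ x := by
  have h : (expMeasure 1).real (Set.Ici 0) = 1 := by
    rw [expMeasure_one_real_Ici le_rfl]; simp
  rw [ae_iff]
  have h2 := probReal_compl_eq_one_sub (μ := expMeasure 1) (measurableSet_Ici (a := (0 : ℝ)))
  rw [h, sub_self, measureReal_eq_zero_iff] at h2
  exact h2

theorem pi_real_pi {ι : Type*} [Fintype ι] (μ : ι → Measure ℝ) [∀ i, IsProbabilityMeasure (μ i)]
    (s : ι → Set ℝ) : (Measure.pi μ).real (Set.pi Set.univ s) = ∏ i, (μ i).real (s i) := by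
  simp [Measure.real, Measure.pi_pi, ENNReal.toReal_prod]

/-! ### Exponential vectors and the first moment integral -/

section

variable {d : ℕ}

/-- The law of a vector with independent standard exponential coordinates. -/
noncomputable abbrev expLaw (d : ℕ) : Measure (Fin d → ℝ) := Measure.pi fun _ => expMeasure 1

theorem expLaw_real_orthant {g : Fin d → ℝ} (hg : ∀ j, 0 ≤ g j) :
    (expLaw d).real (Set.pi Set.univ fun j => Set.Ici (g j)) = Real.exp (-∑ j, g j) := by
  rw [pi_real_pi, ← Finset.sum_neg_distrib, Real.exp_sum]
  exact Finset.prod_congr rfl fun j _ => expMeasure_one_real_Ici (hg j)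

theorem expLaw_real_openOrthant {g : Fin d → ℝ} (hg : ∀ j, 0 ≤ g j) :
    (expLaw d).real (Set.pi Set.univ fun j => Set.Ioi (g j)) = Real.exp (-∑ j, g j) := by
  rw [pi_real_pi, ← Finset.sum_neg_distrib, Real.exp_sum]
  exact Finset.prod_congr rfl fun j _ => expMeasure_one_real_Ioi (hg j)

theorem expLaw_real_box {g : Fin d → ℝ} {h : ℝ} (hg : ∀ j, 0 ≤ g j) (hh : 0 ≤ h) :
    (expLaw d).real (Set.pi Set.univ fun j => Set.Ico (g j) (g j + h)) =
      Real.exp (-∑ j, g j) * (1 - Real.exp (-h)) ^ d := by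
  rw [pi_real_pi, ← Finset.sum_neg_distrib, Real.exp_sum,
    Finset.prod_congr rfl fun j _ => expMeasure_one_real_Ico (hg j) hh, Finset.prod_mul_distrib]
  simp

theorem ae_nonneg_expLaw : ∀ᵐ x ∂expLaw d, ∀ j, 0 ≤ x j :=
  ae_all_iff.2 fun j => (Measure.quasiMeasurePreserving_eval (fun _ : Fin d => expMeasure 1) j).ae
    ae_nonneg_expMeasure_one

theorem lintegral_expLaw_prod (f : ℝ → ENNReal) (hf : Measurable f) :
    ∫⁻ x, ∏ j, f (x j) ∂expLaw d = (∫⁻ x, f x ∂expMeasure 1) ^ d := by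
  have hind : iIndepFun (fun (j : Fin d) (x : Fin d → ℝ) => f (x j)) (expLaw d) :=
    iIndepFun_pi fun _ => hf.aemeasurable
  rw [lintegral_prod_eq_prod_lintegral_of_indepFun _ _ hind
    fun j => hf.comp (measurable_pi_apply j)]
  have : ∀ j : Fin d, ∫⁻ x, f (x j) ∂expLaw d = ∫⁻ x, f x ∂expMeasure 1 := fun j =>
    (measurePreserving_eval (fun _ : Fin d => expMeasure 1) j).lintegral_comp hf
  simp [this]

theorem lintegral_exp_Iic_le (b : ℝ) :
    ∫⁻ x, (Set.Iic b).indicator (fun y => ENNReal.ofReal (Real.exp y)) x ∂expMeasure 1 ≤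
      ENNReal.ofReal b := by
  rw [lintegral_expMeasure_one _ ((by fun_prop : Measurable fun y : ℝ =>
    ENNReal.ofReal (Real.exp y)).indicator measurableSet_Iic)]
  calc _ = ∫⁻ x in Set.Ici 0, (Set.Iic b).indicator 1 x := by
        congr 1 with x
        by_cases hx : x ≤ b
        · simp [hx, ← ENNReal.ofReal_mul (Real.exp_pos _).le, ← Real.exp_add]
        · simp [hx]
    _ = volume (Set.Iic b ∩ Set.Ici (0 : ℝ)) := by
        rw [lintegral_indicator_one measurableSet_Iic, Measure.restrict_apply measurableSet_Iic]
    _ ≤ _ := by rw [Set.inter_comm, Set.Ici_inter_Iic, Real.volume_Icc, sub_zero]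

/-- The function `x ↦ exp (-a e^{-x})` on `(-∞, b]`, extended by zero. -/
noncomputable def truncGumbel (a b x : ℝ) : ENNReal :=
  (Set.Iic b).indicator (fun y => ENNReal.ofReal (Real.exp (-(a * Real.exp (-y))))) x

theorem measurable_truncGumbel (a b : ℝ) : Measurable (truncGumbel a b) :=
  (by fun_prop : Measurable fun y : ℝ =>
    ENNReal.ofReal (Real.exp (-(a * Real.exp (-y))))).indicator measurableSet_Iic

theorem measurable_truncGumbel_add (a b s : ℝ) : Measurable fun x => truncGumbel a b (x + s) :=
  (measurable_truncGumbel a b).comp (measurable_add_const s)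

/-- Against the density e^{-x} the integrand has the explicit antiderivative e^s exp(-a e^{-(x+s)})
/ a. Its value at x = b - s is the bound; the nonnegative value at 0 is dropped. -/
theorem lintegral_truncGumbel_le {a : ℝ} (ha : 0 < a) (s b : ℝ) :
    ∫⁻ x, truncGumbel a b (x + s) ∂expMeasure 1 ≤
      ENNReal.ofReal (Real.exp s) * ENNReal.ofReal (Real.exp (-(a * Real.exp (-b))) / a) := by
  rw [lintegral_expMeasure_one _ (measurable_truncGumbel_add a b s)]
  set F : ℝ → ℝ := fun x => Real.exp s * (Real.exp (-(a * Real.exp (-(x + s)))) / a) with hF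
  set f : ℝ → ℝ := fun x => Real.exp (-x) * Real.exp (-(a * Real.exp (-(x + s)))) with hf
  have hder : ∀ x, HasDerivAt F (f x) x := by
    intro x
    have h1 : HasDerivAt (fun x => -(x + s)) (-1) x := ((hasDerivAt_id x).add_const s).neg
    have h2 := (((h1.exp.const_mul a).neg.exp).div_const a).const_mul (Real.exp s)
    convert! h2 using 1
    simp only [hf, Pi.neg_apply]
    have : Real.exp (-(x + s)) = Real.exp (-x) * (Real.exp s)⁻¹ := by
      rw [neg_add, Real.exp_add, Real.exp_neg s]
    rw [this]
    have := (Real.exp_pos s).ne'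
    field_simp
  rcases lt_or_ge (b - s) 0 with hbs | hbs
  · refine le_trans (le_of_eq ?_) zero_le
    rw [setLIntegral_congr_fun (g := fun _ => 0) measurableSet_Ici, lintegral_zero]
    intro x hx
    have : ¬ x + s ≤ b := by have := Set.mem_Ici.1 hx; linarith
    simp [truncGumbel, this]
  have hcont : Continuous f := by fun_prop
  calc _ = ∫⁻ x in Set.Icc 0 (b - s), ENNReal.ofReal (f x) := by
        rw [← lintegral_indicator measurableSet_Ici, ← lintegral_indicator measurableSet_Icc]
        congr 1 with x
        by_cases h0 : 0 ≤ x
        · by_cases hb : x + s ≤ b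
          · have : x ≤ b - s := by linarith
            simp [h0, hb, this, truncGumbel, hf, ENNReal.ofReal_mul (Real.exp_pos _).le]
          · have : ¬ x ≤ b - s := by intro h; apply hb; linarith
            simp [hb, this, truncGumbel]
        · simp [h0]
    _ = ENNReal.ofReal (∫ x in Set.Icc 0 (b - s), f x) := by
        rw [ofReal_integral_eq_lintegral_ofReal]
        · exact hcont.integrableOn_Icc
        · exact Eventually.of_forall fun x => by positivity
    _ = ENNReal.ofReal (F (b - s) - F 0) := by
        rw [integral_Icc_eq_integral_Ioc, ← intervalIntegral.integral_of_le hbs,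
          intervalIntegral.integral_eq_sub_of_hasDerivAt (fun x _ => hder x)
          (hcont.intervalIntegrable _ _)]
    _ ≤ _ := by
        rw [← ENNReal.ofReal_mul (Real.exp_pos _).le]
        refine ENNReal.ofReal_le_ofReal ?_
        have h0 : 0 ≤ F 0 := by simp only [hF]; positivity
        have h1 : F (b - s) = Real.exp s * (Real.exp (-(a * Real.exp (-b))) / a) := by
          simp only [hF, sub_add_cancel]
        linarith

/-- Integrating out one coordinate leaves a factor e^s, where s is the sum of the other D
coordinates. This cancels their exponential densities, so what remains is the volume of [0, b]^D. -/
theorem lintegral_truncGumbel_sum_le {a b : ℝ} (ha : 0 < a) (D : ℕ) :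
    ∫⁻ x, truncGumbel a b (∑ j, x j) ∂expLaw (D + 1) ≤
      ENNReal.ofReal b ^ D * ENNReal.ofReal (Real.exp (-(a * Real.exp (-b))) / a) := by
  have hmE : Measurable fun y : ℝ =>
      (Set.Iic b).indicator (fun y => ENNReal.ofReal (Real.exp y)) y :=
    (by fun_prop : Measurable fun y : ℝ => ENNReal.ofReal (Real.exp y)).indicator measurableSet_Iic
  have hmI : Measurable fun y : ℝ => (Set.Iic b).indicator (1 : ℝ → ENNReal) y :=
    measurable_one.indicator measurableSet_Iic
  -- Nonnegative coordinates with sum at most b are each at most b, so these indicators cost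
  -- nothing; they keep the integral finite once the sum constraint is given up.
  set G : ℝ × (Fin D → ℝ) → ENNReal := fun p =>
    truncGumbel a b (p.1 + ∑ j, p.2 j) * ∏ j, (Set.Iic b).indicator 1 (p.2 j) with hG
  have hGm : Measurable G := by
    refine Measurable.mul ((measurable_truncGumbel a b).comp (by fun_prop)) ?_
    exact Finset.measurable_fun_prod _ fun j _ => hmI.comp (by fun_prop)
  have hmp := measurePreserving_piFinSuccAbove (fun _ : Fin (D + 1) => expMeasure 1) 0
  calc _ ≤ ∫⁻ x, G (MeasurableEquiv.piFinSuccAbove (fun _ => ℝ) 0 x) ∂expLaw (D + 1) := by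
        refine lintegral_mono_ae ?_
        filter_upwards [ae_nonneg_expLaw] with x hx
        by_cases hb : ∑ j, x j ≤ b
        · have hj : ∀ j, x j ≤ b := fun j =>
            (Finset.single_le_sum (fun i _ => hx i) (Finset.mem_univ j)).trans hb
          have : (∏ j : Fin D, (Set.Iic b).indicator (1 : ℝ → ENNReal) (x j.succ)) = 1 :=
            Finset.prod_eq_one fun j _ => by simp [hj]
          simp [hG, MeasurableEquiv.piFinSuccAbove_apply, Fin.insertNthEquiv, Fin.sum_univ_succ,
            Fin.tail, this]
        · simp [truncGumbel, hb]
    _ = ∫⁻ p, G p ∂((expMeasure 1).prod (expLaw D)) := hmp.lintegral_comp hGm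
    _ = ∫⁻ y, ∫⁻ x, G (x, y) ∂expMeasure 1 ∂expLaw D := lintegral_prod_symm _ hGm.aemeasurable
    _ ≤ ∫⁻ y, ENNReal.ofReal (Real.exp (-(a * Real.exp (-b))) / a) *
          ∏ j, (Set.Iic b).indicator (fun y => ENNReal.ofReal (Real.exp y)) (y j) ∂expLaw D := by
        refine lintegral_mono fun y => ?_
        simp only [hG]
        rw [lintegral_mul_const _ (measurable_truncGumbel_add a b _)]
        refine (mul_le_mul_left (lintegral_truncGumbel_le ha _ b) _).trans (le_of_eq ?_)
        rw [mul_comm (ENNReal.ofReal (Real.exp _)), mul_assoc, Real.exp_sum,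
          ENNReal.ofReal_prod_of_nonneg fun j _ => (Real.exp_pos _).le,
          ← Finset.prod_mul_distrib]
        congr 1
        refine Finset.prod_congr rfl fun j _ => ?_
        by_cases h : y j ≤ b <;> simp [h]
    _ ≤ _ := by
        have hmP : Measurable fun y : Fin D → ℝ => ∏ j, (Set.Iic b).indicator
            (fun y => ENNReal.ofReal (Real.exp y)) (y j) :=
          Finset.measurable_fun_prod _ fun j _ => hmE.comp (measurable_pi_apply j)
        rw [lintegral_const_mul _ hmP, lintegral_expLaw_prod _ hmE, mul_comm]
        gcongr
        exact lintegral_exp_Iic_le b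

end

/-! ### First moment: undominated points of small coordinate-sum -/

section

variable {Ω : Type*} [MeasurableSpace Ω] {P : Measure Ω} {d : ℕ} {X : ℕ → Ω → Fin d → ℝ}

theorem measureReal_biInter_preimage (hmeas : ∀ i, Measurable (X i)) (hindep : iIndepFun X P)
    (hlaw : ∀ i, P.map (X i) = expLaw d) (s : Finset ℕ) {A : ℕ → Set (Fin d → ℝ)}
    (hA : ∀ i, MeasurableSet (A i)) :
    P.real (⋂ i ∈ s, X i ⁻¹' A i) = ∏ i ∈ s, (expLaw d).real (A i) := by
  rw [Measure.real, hindep.measure_inter_preimage_eq_mul s fun i _ => hA i, ENNReal.toReal_prod]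
  refine Finset.prod_congr rfl fun i _ => ?_
  rw [Measure.real, ← hlaw i, Measure.map_apply (hmeas i) (hA i)]

theorem measurableSet_openOrthant (x : Fin d → ℝ) :
    MeasurableSet (Set.pi Set.univ fun j => Set.Ioi (x j)) :=
  MeasurableSet.univ_pi fun _ => measurableSet_Ioi

/-- Condition on X i = x. Since i is not in T, the points indexed by T are independent of x, and
each dominates x with probability q = e^{-∑ x j}. None does with probability (1 - q)^|T| ≤ exp(-|T|
q). -/
theorem measure_undominated_le [IsProbabilityMeasure P] (hmeas : ∀ i, Measurable (X i)) (hindep : iIndepFun X P)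
    (hlaw : ∀ i, P.map (X i) = expLaw d) (b : ℝ) {i : ℕ} {T : Finset ℕ} (hi : i ∉ T) :
    P {ω | ∑ j, X i ω j ≤ b ∧ ∀ l ∈ T, ¬ ∀ j, X i ω j < X l ω j} ≤
      ∫⁻ x, truncGumbel T.card b (∑ j, x j) ∂expLaw d := by
  set Y : Ω → T → Fin d → ℝ := fun ω l => X l ω with hY
  have hYm : Measurable Y := measurable_pi_lambda _ fun l => hmeas l
  have hind : IndepFun (X i) Y P := by
    have h := hindep.indepFun_finset {i} T (Finset.disjoint_singleton_left.2 hi) hmeas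
    exact h.comp (φ := fun f : ({i} : Finset ℕ) → Fin d → ℝ => f ⟨i, Finset.mem_singleton_self i⟩)
      (measurable_pi_apply _) measurable_id
  set S : Set ((Fin d → ℝ) × (T → Fin d → ℝ)) :=
    {p | ∑ j, p.1 j ≤ b ∧ ∀ l, ¬ ∀ j, p.1 j < p.2 l j} with hS
  have hSm : MeasurableSet S := by
    refine MeasurableSet.inter (measurableSet_le
      (f := fun p : (Fin d → ℝ) × (T → Fin d → ℝ) => ∑ j, p.1 j) (by fun_prop)
      measurable_const) ?_
    refine measurableSet_setOfPred.2 (Measurable.forall fun l => Measurable.not ?_)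
    exact Measurable.forall fun j => measurableSet_setOfPred.1 (measurableSet_lt
      (f := fun p : (Fin d → ℝ) × (T → Fin d → ℝ) => p.1 j) (g := fun p => p.2 l j)
      (by fun_prop) (by fun_prop))
  have hset : {ω | ∑ j, X i ω j ≤ b ∧ ∀ l ∈ T, ¬ ∀ j, X i ω j < X l ω j} =
      (fun ω => (X i ω, Y ω)) ⁻¹' S := by
    ext ω
    simp [hS, hY]
  rw [hset, ← Measure.map_apply ((hmeas i).prodMk hYm) hSm,
    hind.map_prod_eq_prod_map_map (hmeas i).aemeasurable hYm.aemeasurable, hlaw i,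
    Measure.prod_apply hSm]
  refine lintegral_mono_ae ?_
  filter_upwards [ae_nonneg_expLaw] with x hx
  by_cases hb : ∑ j, x j ≤ b
  swap
  · have : Prod.mk x ⁻¹' S = ∅ := by
      ext y
      simp [hS, hb]
    simp [this]
  have hpre : Y ⁻¹' (Prod.mk x ⁻¹' S) =
      ⋂ l ∈ T, X l ⁻¹' (Set.pi Set.univ fun j => Set.Ioi (x j))ᶜ := by
    ext ω
    simp [hS, hY, hb, Set.mem_pi]
  have hq0 : Real.exp (-∑ j, x j) ≤ 1 :=
    Real.exp_le_one_iff.2 (neg_nonpos.2 (Finset.sum_nonneg fun j _ => hx j))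
  rw [Measure.map_apply hYm (measurable_prodMk_left hSm), hpre, ← ofReal_measureReal,
    measureReal_biInter_preimage hmeas hindep hlaw T
      fun _ => (measurableSet_openOrthant x).compl]
  simp only [Finset.prod_const, truncGumbel, Set.indicator, Set.mem_Iic, hb, if_true]
  refine ENNReal.ofReal_le_ofReal ?_
  rw [probReal_compl_eq_one_sub (measurableSet_openOrthant x), expLaw_real_openOrthant hx,
    ← mul_neg, Real.exp_nat_mul]
  exact pow_le_pow_left₀ (by linarith) (Real.one_sub_le_exp_neg _) _

end

/-- First moment bound for the existence of a point with small coordinate-sum among the first `n₂`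
that is not dominated by any of the first `n₁`. -/
theorem measure_exists_undominated_le {Ω : Type*} [MeasurableSpace Ω] {P : Measure Ω}
    [IsProbabilityMeasure P] {D : ℕ} {X : ℕ → Ω → Fin (D + 1) → ℝ}
    (hmeas : ∀ i, Measurable (X i)) (hindep : iIndepFun X P)
    (hlaw : ∀ i, P.map (X i) = expLaw (D + 1)) {b : ℝ} (hb : 0 ≤ b) {n₁ : ℕ} (hn₁ : 2 ≤ n₁)
    (n₂ : ℕ) :
    P {ω | ∃ i < n₂, ∑ j, X i ω j ≤ b ∧ ∀ l < n₁, ¬ ∀ j, X i ω j < X l ω j} ≤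
      ENNReal.ofReal (n₂ / (n₁ - 1) * b ^ D * Real.exp (-((n₁ - 1) * Real.exp (-b)))) := by
  have hn : (0 : ℝ) < n₁ - 1 := by
    have : (2 : ℝ) ≤ n₁ := by exact_mod_cast hn₁
    linarith
  have hsub : {ω | ∃ i < n₂, ∑ j, X i ω j ≤ b ∧ ∀ l < n₁, ¬ ∀ j, X i ω j < X l ω j} ⊆
      ⋃ i ∈ Finset.range n₂, {ω | ∑ j, X i ω j ≤ b ∧
        ∀ l ∈ (Finset.range n₁).erase i, ¬ ∀ j, X i ω j < X l ω j} := by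
    rintro ω ⟨i, hi, h1, h2⟩
    simp only [Set.mem_iUnion, Finset.mem_range]
    exact ⟨i, hi, h1, fun l hl => h2 l (Finset.mem_range.1 (Finset.mem_of_mem_erase hl))⟩
  have hone : ∀ i, P {ω | ∑ j, X i ω j ≤ b ∧
      ∀ l ∈ (Finset.range n₁).erase i, ¬ ∀ j, X i ω j < X l ω j} ≤
      ENNReal.ofReal (b ^ D * (Real.exp (-((n₁ - 1) * Real.exp (-b))) / (n₁ - 1))) := by
    intro i
    refine (measure_undominated_le hmeas hindep hlaw b (Finset.notMem_erase i _)).trans ?_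
    -- The index i may itself be among the first n₁, in which case one possible dominator is lost.
    have hcard : (n₁ : ℝ) - 1 ≤ ((Finset.range n₁).erase i).card := by
      have h := Finset.pred_card_le_card_erase (s := Finset.range n₁) (a := i)
      rw [Finset.card_range] at h
      have : n₁ ≤ ((Finset.range n₁).erase i).card + 1 := by omega
      have : (n₁ : ℝ) ≤ ((Finset.range n₁).erase i).card + 1 := by exact_mod_cast this
      linarith
    have hmono : ∀ s, truncGumbel ((Finset.range n₁).erase i).card b s ≤
        truncGumbel (n₁ - 1) b s := by
      intro s
      refine Set.indicator_le_indicator (ENNReal.ofReal_le_ofReal ?_)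
      gcongr
    refine (lintegral_mono fun x => hmono _).trans
      ((lintegral_truncGumbel_sum_le hn D).trans (le_of_eq ?_))
    rw [ENNReal.ofReal_mul (pow_nonneg hb D), ENNReal.ofReal_pow hb]
  refine (measure_mono hsub).trans ((measure_biUnion_finset_le _ _).trans
    ((Finset.sum_le_sum fun i _ => hone i).trans (le_of_eq ?_)))
  rw [Finset.sum_const, Finset.card_range, nsmul_eq_mul, ← ENNReal.ofReal_natCast,
    ← ENNReal.ofReal_mul (Nat.cast_nonneg _)]
  congr 1
  ring

/-! ### Second moment inequality -/

/-- The second moment method for a finite family of events. -/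
theorem measureReal_biInter_compl_le {Ω α : Type*} [MeasurableSpace Ω] {P : Measure Ω}
    [IsProbabilityMeasure P] (s : Finset α) {E : α → Set Ω} (hE : ∀ a, MeasurableSet (E a))
    (hpos : 0 < ∑ a ∈ s, P.real (E a)) :
    P.real (⋂ a ∈ s, (E a)ᶜ) ≤
      (∑ a ∈ s, ∑ b ∈ s, P.real (E a ∩ E b)) / (∑ a ∈ s, P.real (E a)) ^ 2 - 1 := by
  set m := ∑ a ∈ s, P.real (E a) with hm
  set N : Ω → ℝ := fun ω => ∑ a ∈ s, (E a).indicator 1 ω with hN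
  have hint : ∀ A : Set Ω, MeasurableSet A → Integrable (A.indicator (1 : Ω → ℝ)) P :=
    fun A hA => (integrable_const (1 : ℝ)).indicator hA
  have hNint : Integrable N P := integrable_finsetSum _ fun a _ => hint _ (hE a)
  have hN1 : ∫ ω, N ω ∂P = m := by
    rw [integral_finsetSum _ fun a _ => hint _ (hE a)]
    exact Finset.sum_congr rfl fun a _ => integral_indicator_one (hE a)
  have hsq : ∀ ω, N ω ^ 2 = ∑ a ∈ s, ∑ b ∈ s, (E a ∩ E b).indicator 1 ω := by
    intro ω
    simp only [hN, sq, Finset.sum_mul_sum, Set.inter_indicator_one, Pi.mul_apply]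
  have hsqint : Integrable (fun ω => N ω ^ 2) P := by
    simp only [hsq]
    exact integrable_finsetSum _ fun a _ => integrable_finsetSum _ fun b _ =>
      hint _ ((hE a).inter (hE b))
  have hN2 : ∫ ω, N ω ^ 2 ∂P = ∑ a ∈ s, ∑ b ∈ s, P.real (E a ∩ E b) := by
    simp only [hsq]
    rw [integral_finsetSum _ fun a _ => integrable_finsetSum _ fun b _ =>
      hint _ ((hE a).inter (hE b))]
    refine Finset.sum_congr rfl fun a _ => ?_
    rw [integral_finsetSum _ fun b _ => hint _ ((hE a).inter (hE b))]
    exact Finset.sum_congr rfl fun b _ => integral_indicator_one ((hE a).inter (hE b))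
  have hZ : MeasurableSet (⋂ a ∈ s, (E a)ᶜ) := Finset.measurableSet_biInter _ fun a _ => (hE a).compl
  rw [← integral_indicator_one hZ]
  -- Chebyshev in pointwise form: the indicator of N = 0 is at most (N / m - 1)^2, whose integral is
  -- E N^2 / m^2 - 1.
  have key : ∀ ω, (⋂ a ∈ s, (E a)ᶜ).indicator (1 : Ω → ℝ) ω ≤
      N ω ^ 2 / m ^ 2 - 2 / m * N ω + 1 := by
    intro ω
    by_cases h : ω ∈ ⋂ a ∈ s, (E a)ᶜ
    · have : N ω = 0 := by
        refine Finset.sum_eq_zero fun a ha => ?_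
        have := Set.mem_iInter₂.1 h a ha
        exact Set.indicator_of_notMem this _
      simp [h, this]
    · rw [Set.indicator_of_notMem h]
      have : N ω ^ 2 / m ^ 2 - 2 / m * N ω + 1 = (N ω / m - 1) ^ 2 := by
        field_simp
        ring
      rw [this]
      positivity
  have h2 := hNint.const_mul (2 / m)
  have h1 := hsqint.div_const (m ^ 2)
  refine (integral_mono (hint _ hZ) ((h1.sub h2).add (integrable_const 1)) key).trans (le_of_eq ?_)
  simp only [Pi.add_apply]
  rw [integral_add (h1.sub h2) (integrable_const 1), integral_sub' h1 h2, integral_div,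
    integral_const_mul, hN1, hN2]
  simp only [integral_const, probReal_univ, smul_eq_mul]
  field_simp
  ring

/-! ### Points that are alone in an orthant -/

section

variable {d : ℕ}

theorem measurableSet_orthant (g : Fin d → ℝ) :
    MeasurableSet (Set.pi Set.univ fun j => Set.Ici (g j)) :=
  MeasurableSet.univ_pi fun _ => measurableSet_Ici

theorem measurableSet_box (g : Fin d → ℝ) (h : ℝ) :
    MeasurableSet (Set.pi Set.univ fun j => Set.Ico (g j) (g j + h)) :=
  MeasurableSet.univ_pi fun _ => measurableSet_Ico

/-- The event that `X i` lies in the box `g + [0, h)^d` and is the only one of the first `n` points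
in the orthant `g + [0, ∞)^d`. -/
def soleInOrthant {Ω : Type*} (X : ℕ → Ω → Fin d → ℝ) (n : ℕ) (h : ℝ) (g : Fin d → ℝ) (i : ℕ) :
    Set Ω :=
  ⋂ l ∈ Finset.range n, X l ⁻¹' (if l = i then Set.pi Set.univ fun j => Set.Ico (g j) (g j + h)
    else (Set.pi Set.univ fun j => Set.Ici (g j))ᶜ)

theorem mem_soleInOrthant {Ω : Type*} {X : ℕ → Ω → Fin d → ℝ} {n : ℕ} {h : ℝ} {g : Fin d → ℝ}
    {i : ℕ} (hi : i < n) {ω : Ω} : ω ∈ soleInOrthant X n h g i ↔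
      (∀ j, g j ≤ X i ω j ∧ X i ω j < g j + h) ∧ ∀ l < n, l ≠ i → ¬ ∀ j, g j ≤ X l ω j := by
  simp only [soleInOrthant, Set.mem_iInter, Finset.mem_range, Set.mem_preimage]
  constructor
  · intro H
    refine ⟨fun j => ?_, fun l hl hli => ?_⟩
    · have := H i hi
      rw [if_pos rfl] at this
      exact this j trivial
    · have := H l hl
      rw [if_neg hli] at this
      exact fun h => this fun j _ => h j
  · rintro ⟨h1, h2⟩ l hl
    split_ifs with hli
    · subst hli
      exact fun j _ => h1 j
    · exact fun h => h2 l hl hli fun j => h j trivial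

variable {Ω : Type*} [MeasurableSpace Ω] {P : Measure Ω} {X : ℕ → Ω → Fin d → ℝ}

theorem measurableSet_soleInOrthant (hmeas : ∀ i, Measurable (X i)) (n : ℕ) (h : ℝ)
    (g : Fin d → ℝ) (i : ℕ) : MeasurableSet (soleInOrthant X n h g i) := by
  refine Finset.measurableSet_biInter _ fun l _ => hmeas l ?_
  split_ifs
  exacts [measurableSet_box g h, (measurableSet_orthant g).compl]

theorem measureReal_soleInOrthant (hmeas : ∀ i, Measurable (X i)) (hindep : iIndepFun X P)
    (hlaw : ∀ i, P.map (X i) = expLaw d) {n : ℕ} {h : ℝ} (hh : 0 ≤ h) {g : Fin d → ℝ}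
    (hg : ∀ j, 0 ≤ g j) {i : ℕ} (hi : i < n) :
    P.real (soleInOrthant X n h g i) = Real.exp (-∑ j, g j) * (1 - Real.exp (-h)) ^ d *
      (1 - Real.exp (-∑ j, g j)) ^ (n - 1) := by
  rw [soleInOrthant, measureReal_biInter_preimage hmeas hindep hlaw _ fun l => by
      split_ifs
      exacts [measurableSet_box g h, (measurableSet_orthant g).compl],
    ← Finset.mul_prod_erase _ _ (Finset.mem_range.2 hi), if_pos rfl, expLaw_real_box hg hh,
    Finset.prod_congr rfl fun l hl => by rw [if_neg (Finset.ne_of_mem_erase hl)],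
    Finset.prod_const, Finset.card_erase_of_mem (Finset.mem_range.2 hi), Finset.card_range,
    probReal_compl_eq_one_sub (measurableSet_orthant g), expLaw_real_orthant hg]

/-- All points other than X i and X i' avoid both orthants. The orthants meet in the orthant at the
coordinatewise maximum, so inclusion–exclusion gives the measure of their union. -/
theorem measureReal_inter_soleInOrthant_le (hmeas : ∀ i, Measurable (X i)) (hindep : iIndepFun X P)
    (hlaw : ∀ i, P.map (X i) = expLaw d) {n : ℕ} {h : ℝ} (hh : 0 ≤ h) {g g' : Fin d → ℝ}
    (hg : ∀ j, 0 ≤ g j) (hg' : ∀ j, 0 ≤ g' j) {i i' : ℕ} (hi : i < n) (hi' : i' < n)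
    (hii' : i ≠ i') :
    P.real (soleInOrthant X n h g i ∩ soleInOrthant X n h g' i') ≤
      (Real.exp (-∑ j, g j) * (1 - Real.exp (-h)) ^ d) *
      (Real.exp (-∑ j, g' j) * (1 - Real.exp (-h)) ^ d) *
      (1 - Real.exp (-∑ j, g j) - Real.exp (-∑ j, g' j)
        + Real.exp (-∑ j, max (g j) (g' j))) ^ (n - 2) := by
  have hP := hindep.isProbabilityMeasure
  set C : (Fin d → ℝ) → Set (Fin d → ℝ) := fun g => Set.pi Set.univ fun j => Set.Ici (g j) with hC
  set Q : (Fin d → ℝ) → Set (Fin d → ℝ) := fun g => Set.pi Set.univ fun j => Set.Ico (g j) (g j + h)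
    with hQ
  have hCm : ∀ g, MeasurableSet (C g) := measurableSet_orthant
  have hQm : ∀ g, MeasurableSet (Q g) := fun g => measurableSet_box g h
  set A : ℕ → Set (Fin d → ℝ) := fun l =>
    if l = i then Q g else if l = i' then Q g' else (C g ∪ C g')ᶜ with hA
  have hAm : ∀ l, MeasurableSet (A l) := by
    intro l
    simp only [hA]
    split_ifs
    exacts [hQm _, hQm _, ((hCm _).union (hCm _)).compl]
  have hsub : soleInOrthant X n h g i ∩ soleInOrthant X n h g' i' ⊆
      ⋂ l ∈ Finset.range n, X l ⁻¹' A l := by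
    rintro ω ⟨h1, h2⟩
    rw [mem_soleInOrthant hi] at h1
    rw [mem_soleInOrthant hi'] at h2
    simp only [Set.mem_iInter, Finset.mem_range, Set.mem_preimage, hA]
    intro l hl
    split_ifs with hli hli'
    · subst hli
      exact fun j _ => h1.1 j
    · subst hli'
      exact fun j _ => h2.1 j
    · rintro (hc | hc)
      exacts [h1.2 l hl hli fun j => hc j trivial, h2.2 l hl hli' fun j => hc j trivial]
  refine (measureReal_mono hsub).trans (le_of_eq ?_)
  have hmem : i' ∈ (Finset.range n).erase i :=
    Finset.mem_erase.2 ⟨hii'.symm, Finset.mem_range.2 hi'⟩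
  have hAi : A i = Q g := if_pos rfl
  have hAi' : A i' = Q g' := by simp [hA, hii'.symm]
  have hAl : ∀ l ∈ ((Finset.range n).erase i).erase i',
      (expLaw d).real (A l) = (expLaw d).real (C g ∪ C g')ᶜ := by
    intro l hl
    have h1 := Finset.ne_of_mem_erase hl
    have h2 := Finset.ne_of_mem_erase (Finset.mem_of_mem_erase hl)
    simp [hA, h1, h2]
  have hCC : C g ∩ C g' = C fun j => max (g j) (g' j) := by
    ext x
    simp [hC, Pi.le_def, forall_and]
  have hunion := measureReal_union_add_inter (μ := expLaw d) (s := C g) (hCm g')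
  rw [hCC, expLaw_real_orthant hg, expLaw_real_orthant hg',
    expLaw_real_orthant fun j => (hg j).trans (le_max_left _ _)] at hunion
  rw [measureReal_biInter_preimage hmeas hindep hlaw _ hAm,
    ← Finset.mul_prod_erase _ _ (Finset.mem_range.2 hi), ← Finset.mul_prod_erase _ _ hmem,
    Finset.prod_congr rfl hAl, Finset.prod_const, Finset.card_erase_of_mem hmem,
    Finset.card_erase_of_mem (Finset.mem_range.2 hi), Finset.card_range, hAi, hAi',
    expLaw_real_box hg hh, expLaw_real_box hg' hh,
    probReal_compl_eq_one_sub ((hCm g).union (hCm g')), ← mul_assoc, Nat.sub_sub]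
  congr 2
  linarith

end

/-! ### The simplex grid and the overlap of its orthants -/

section

variable {D : ℕ}

/-- A point of the simplex-shaped grid of mesh `h` on the hyperplane where the coordinates add up
to `b`. -/
noncomputable def gridPoint (b h : ℝ) (v : Fin D → ℕ) : Fin (D + 1) → ℝ :=
  Fin.cons (b - ∑ j, h * v j) fun j => h * v j

theorem sum_gridPoint (b h : ℝ) (v : Fin D → ℕ) : ∑ j, gridPoint b h v j = b := by
  simp [gridPoint, Fin.sum_univ_succ]

/-- The first coordinate absorbs the other D, and the bound on h K D keeps it nonnegative.
Nonnegative corners are needed for the exact orthant and box probabilities. -/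
theorem gridPoint_nonneg {b h : ℝ} (hh : 0 ≤ h) {K : ℕ} (hK : h * K * D ≤ b) {v : Fin D → ℕ}
    (hv : ∀ j, v j < K) (j : Fin (D + 1)) : 0 ≤ gridPoint b h v j := by
  refine Fin.cases ?_ (fun j => ?_) j
  · have : ∑ j, h * (v j : ℝ) ≤ ∑ _j : Fin D, h * K := by
      refine Finset.sum_le_sum fun j _ => ?_
      have : (v j : ℝ) ≤ K := by exact_mod_cast (hv j).le
      gcongr
    simp only [Finset.sum_const, Finset.card_univ, Fintype.card_fin, nsmul_eq_mul] at this
    simp only [gridPoint, Fin.cons_zero]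
    linarith
  · simp only [gridPoint, Fin.cons_succ]
    positivity

/-- The excess of ∑ max over b is the sum of the positive parts of g' - g and, the two sums being
equal, also of g - g'. One of the two contains the term |g j - g' j|. -/
theorem add_abs_sub_le_sum_max {ι : Type*} [Fintype ι] {g g' : ι → ℝ} {b : ℝ}
    (hg : ∑ j, g j = b) (hg' : ∑ j, g' j = b) (j : ι) :
    b + |g j - g' j| ≤ ∑ i, max (g i) (g' i) := by
  have h1 : ∑ i, max (g i) (g' i) = b + ∑ i, (max (g i) (g' i) - g i) := by
    rw [Finset.sum_sub_distrib, hg]; ring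
  have h2 : ∑ i, max (g i) (g' i) = b + ∑ i, (max (g i) (g' i) - g' i) := by
    rw [Finset.sum_sub_distrib, hg']; ring
  have h3 := Finset.single_le_sum (f := fun i => max (g i) (g' i) - g i)
    (fun i _ => sub_nonneg.2 (le_max_left _ _)) (Finset.mem_univ j)
  have h4 := Finset.single_le_sum (f := fun i => max (g i) (g' i) - g' i)
    (fun i _ => sub_nonneg.2 (le_max_right _ _)) (Finset.mem_univ j)
  rcases le_total (g j) (g' j) with h | h
  · rw [max_eq_right h] at h3
    rw [abs_of_nonpos (by linarith)]
    linarith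
  · rw [max_eq_left h] at h4
    rw [abs_of_nonneg (by linarith)]
    linarith

/-- The grid indices at sup-distance at most `ρ`. -/
def IsNear (ρ : ℕ) (v w : Fin D → ℕ) : Prop := ∀ j, v j ≤ w j + ρ ∧ w j ≤ v j + ρ

theorem card_isNear_le (s : Finset (Fin D → ℕ)) (ρ : ℕ) (v : Fin D → ℕ)
    [DecidablePred (IsNear ρ v)] : (s.filter (IsNear ρ v)).card ≤ (2 * ρ + 1) ^ D := by
  have hsub : s.filter (IsNear ρ v) ⊆ Fintype.piFinset fun j => Finset.Icc (v j - ρ) (v j + ρ) := by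
    intro w hw
    have := (Finset.mem_filter.1 hw).2
    refine Fintype.mem_piFinset.2 fun j => Finset.mem_Icc.2 ⟨?_, (this j).2⟩
    have := (this j).1
    omega
  refine (Finset.card_le_card hsub).trans ?_
  rw [Fintype.card_piFinset]
  refine (Finset.prod_le_pow_card _ _ (2 * ρ + 1) fun j _ => ?_).trans (by simp)
  rw [Nat.card_Icc]
  omega

theorem le_sum_max_gridPoint {b h : ℝ} (hh : 0 ≤ h) {ρ : ℕ} {v w : Fin D → ℕ}
    (hvw : ¬ IsNear ρ v w) :
    b + h * (ρ + 1) ≤ ∑ j, max (gridPoint b h v j) (gridPoint b h w j) := by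
  simp only [IsNear, not_forall] at hvw
  obtain ⟨j, hj⟩ := hvw
  refine le_trans ?_ (add_abs_sub_le_sum_max (sum_gridPoint b h v) (sum_gridPoint b h w) j.succ)
  simp only [gridPoint, Fin.cons_succ]
  rw [← mul_sub, abs_mul, abs_of_nonneg hh]
  have : (ρ + 1 : ℝ) ≤ |(v j : ℝ) - w j| := by
    rw [le_abs]
    by_cases h1 : v j ≤ w j + ρ
    · right
      have : v j + (ρ + 1) ≤ w j := by omega
      have : (v j + (ρ + 1) : ℝ) ≤ w j := by exact_mod_cast this
      linarith
    · left
      have : w j + (ρ + 1) ≤ v j := by omega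
      have : (w j + (ρ + 1) : ℝ) ≤ v j := by exact_mod_cast this
      linarith
  gcongr

/-- Three zones around v: within ρ there are few indices and the overlap is bounded by 1; within R
there are more, but the overlap is at most e^{-h(ρ+1)}; beyond R all of s is allowed, at overlap
e^{-h(R+1)}. -/
theorem sum_exp_overlap_le {b h l : ℝ} (hh : 0 ≤ h) (hl : 0 ≤ l) (s : Finset (Fin D → ℕ))
    (ρ R : ℕ) (v : Fin D → ℕ) :
    ∑ w ∈ s, Real.exp (l * Real.exp
        (b - ∑ j, max (gridPoint b h v j) (gridPoint b h w j))) ≤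
      (2 * ρ + 1) ^ D * Real.exp l + (2 * R + 1) ^ D * Real.exp (l * Real.exp (-(h * (ρ + 1))))
        + s.card * Real.exp (l * Real.exp (-(h * (R + 1)))) := by
  classical
  have hpt : ∀ w ∈ s, Real.exp (l * Real.exp
        (b - ∑ j, max (gridPoint b h v j) (gridPoint b h w j))) ≤
      (if IsNear ρ v w then Real.exp l else 0)
        + (if IsNear R v w then Real.exp (l * Real.exp (-(h * (ρ + 1)))) else 0)
        + Real.exp (l * Real.exp (-(h * (R + 1)))) := by
    intro w _
    have hA := Real.exp_pos l
    have hB := Real.exp_pos (l * Real.exp (-(h * (ρ + 1))))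
    have hC := Real.exp_pos (l * Real.exp (-(h * (R + 1))))
    by_cases h1 : IsNear ρ v w
    · have h0 : Real.exp (l * Real.exp
          (b - ∑ j, max (gridPoint b h v j) (gridPoint b h w j))) ≤ Real.exp l := by
        refine Real.exp_le_exp.2 (mul_le_of_le_one_right hl (Real.exp_le_one_iff.2 ?_))
        have := (abs_nonneg _).trans (le_sub_iff_add_le'.2 (add_abs_sub_le_sum_max
          (sum_gridPoint b h v) (sum_gridPoint b h w) 0))
        linarith
      rw [if_pos h1]
      split_ifs <;> linarith
    · rw [if_neg h1]
      by_cases h2 : IsNear R v w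
      · rw [if_pos h2]
        have := le_sum_max_gridPoint (b := b) hh h1
        have h0 : Real.exp (l * Real.exp
            (b - ∑ j, max (gridPoint b h v j) (gridPoint b h w j))) ≤
            Real.exp (l * Real.exp (-(h * (ρ + 1)))) := by
          gcongr
          linarith
        linarith
      · rw [if_neg h2]
        have := le_sum_max_gridPoint (b := b) hh h2
        have h0 : Real.exp (l * Real.exp
            (b - ∑ j, max (gridPoint b h v j) (gridPoint b h w j))) ≤
            Real.exp (l * Real.exp (-(h * (R + 1)))) := by
          gcongr
          linarith
        linarith
  refine (Finset.sum_le_sum hpt).trans ?_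
  rw [Finset.sum_add_distrib, Finset.sum_add_distrib, ← Finset.sum_filter, ← Finset.sum_filter,
    Finset.sum_const, Finset.sum_const, Finset.sum_const, nsmul_eq_mul, nsmul_eq_mul, nsmul_eq_mul]
  have c1 : ((s.filter (IsNear ρ v)).card : ℝ) ≤ (2 * ρ + 1) ^ D := by
    exact_mod_cast card_isNear_le s ρ v
  have c2 : ((s.filter (IsNear R v)).card : ℝ) ≤ (2 * R + 1) ^ D := by
    exact_mod_cast card_isNear_le s R v
  gcongr

end

/-- Compares the joint emptiness of two orthants with independence: 1 - 2q + qe ≤ (1 - q)^2 + qe ≤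
(1 - q)^2 exp(qe / (1 - q)^2). The extra ((1 - q)^2)⁻¹ accounts for the exponent n - 2 in place of n
- 1. -/
theorem overlap_pow_le {q e : ℝ} (hq0 : 0 ≤ q) (hq1 : q ≤ 1 / 2) (he : 0 ≤ e) {n : ℕ}
    (hn : 2 ≤ n) :
    (1 - 2 * q + q * e) ^ (n - 2) ≤
      (1 - q) ^ (2 * (n - 1)) * (((1 - q) ^ 2)⁻¹ * Real.exp (n * q / (1 - q) ^ 2 * e)) := by
  have hq : 0 < 1 - q := by linarith
  set x := q / (1 - q) ^ 2 * e with hx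
  have hx0 : 0 ≤ x := by positivity
  have h1 : 1 - 2 * q + q * e ≤ (1 - q) ^ 2 * Real.exp x := by
    have h2 : (1 - q) ^ 2 * (x + 1) ≤ (1 - q) ^ 2 * Real.exp x :=
      mul_le_mul_of_nonneg_left (Real.add_one_le_exp x) (by positivity)
    have h3 : (1 - q) ^ 2 * (x + 1) = q * e + (1 - q) ^ 2 := by
      rw [hx]
      field_simp
    nlinarith [sq_nonneg q]
  have h0 : 0 ≤ 1 - 2 * q + q * e := by nlinarith [mul_nonneg hq0 he]
  refine (pow_le_pow_left₀ h0 h1 _).trans ?_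
  obtain ⟨m, rfl⟩ := Nat.exists_eq_add_of_le hn
  have e1 : 2 + m - 2 = m := by omega
  have e2 : 2 * (2 + m - 1) = 2 * m + 2 := by omega
  rw [e1, e2, mul_pow, ← Real.exp_nat_mul, ← pow_mul, pow_add, mul_assoc,
    mul_inv_cancel_left₀ (by positivity)]
  have h4 : (m : ℝ) * x ≤ ((2 + m : ℕ) : ℝ) * q / (1 - q) ^ 2 * e := by
    have : ((2 + m : ℕ) : ℝ) * q / (1 - q) ^ 2 * e = (2 + m : ℕ) * x := by rw [hx]; ring
    rw [this]
    refine mul_le_mul_of_nonneg_right ?_ hx0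
    exact_mod_cast (by omega : m ≤ 2 + m)
  exact mul_le_mul_of_nonneg_left (Real.exp_le_exp.2 h4) (by positivity)

/-- Second moment bound: the probability that no point among the first `n₁` with coordinate-sum at
most `b + (D + 1) h` is undominated by the first `n₂` points. -/
theorem measureReal_not_exists_undominated_le {Ω : Type*} [MeasurableSpace Ω] {P : Measure Ω}
    [IsProbabilityMeasure P] {D : ℕ} {X : ℕ → Ω → Fin (D + 1) → ℝ}
    (hmeas : ∀ i, Measurable (X i)) (hindep : iIndepFun X P)
    (hlaw : ∀ i, P.map (X i) = expLaw (D + 1)) {b h : ℝ} (hb : Real.exp (-b) ≤ 1 / 2) (hh : 0 < h) {K : ℕ}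
    (hK1 : 1 ≤ K) (hK : h * K * D ≤ b) {n₁ n₂ : ℕ} (hn₁ : 2 ≤ n₁) (hn : n₁ ≤ n₂) (ρ R : ℕ) :
    P.real {ω | ¬ ∃ i < n₁, ∑ j, X i ω j ≤ b + (D + 1) * h ∧
        ∀ l < n₂, ¬ ∀ j, X i ω j < X l ω j} ≤
      (K ^ D * n₁ * (Real.exp (-b) * (1 - Real.exp (-h)) ^ (D + 1) *
        (1 - Real.exp (-b)) ^ (n₂ - 1)))⁻¹ +
      ((1 - Real.exp (-b)) ^ 2)⁻¹ *
        (((2 * ρ + 1) / K) ^ D * Real.exp (n₂ * Real.exp (-b) / (1 - Real.exp (-b)) ^ 2)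
        + ((2 * R + 1) / K) ^ D * Real.exp (n₂ * Real.exp (-b) / (1 - Real.exp (-b)) ^ 2 *
            Real.exp (-(h * (ρ + 1))))
        + Real.exp (n₂ * Real.exp (-b) / (1 - Real.exp (-b)) ^ 2 * Real.exp (-(h * (R + 1))))) - 1 := by
  classical
  set q := Real.exp (-b) with hq
  have hq0 : 0 < q := Real.exp_pos _
  have hq1 : q < 1 := by linarith
  set w := (1 - Real.exp (-h)) ^ (D + 1) with hw
  have hw0 : 0 < w := pow_pos (sub_pos.2 (Real.exp_lt_one_iff.2 (by linarith))) _
  set p := q * w * (1 - q) ^ (n₂ - 1) with hp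
  have hp0 : 0 < p := mul_pos (mul_pos hq0 hw0) (pow_pos (sub_pos.2 hq1) _)
  set lam := n₂ * q / (1 - q) ^ 2 with hlam
  have hlam0 : 0 ≤ lam := by positivity
  set G : Finset (Fin D → ℕ) := Fintype.piFinset fun _ => Finset.range K with hG
  have hGcard : (G.card : ℝ) = K ^ D := by simp [hG, Fintype.card_piFinset]
  have hGmem : ∀ v ∈ G, ∀ j, v j < K := fun v hv j =>
    Finset.mem_range.1 (Fintype.mem_piFinset.1 hv j)
  have hgn : ∀ v ∈ G, ∀ j, 0 ≤ gridPoint b h v j := fun v hv =>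
    gridPoint_nonneg hh.le hK (hGmem v hv)
  set E : (Fin D → ℕ) × ℕ → Set Ω := fun a => soleInOrthant X n₂ h (gridPoint b h a.1) a.2 with hE
  set S : Finset ((Fin D → ℕ) × ℕ) := G ×ˢ Finset.range n₁ with hS
  have hlt : ∀ i ∈ Finset.range n₁, i < n₂ := fun i hi => (Finset.mem_range.1 hi).trans_le hn
  have hEp : ∀ a ∈ S, P.real (E a) = p := by
    intro a ha
    obtain ⟨h1, h2⟩ := Finset.mem_product.1 ha
    rw [hE]
    simp only
    rw [measureReal_soleInOrthant hmeas hindep hlaw hh.le (hgn _ h1) (hlt _ h2), sum_gridPoint]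
  have hsum : ∑ a ∈ S, P.real (E a) = K ^ D * n₁ * p := by
    rw [Finset.sum_congr rfl hEp, Finset.sum_const, nsmul_eq_mul, hS, Finset.card_product,
      Finset.card_range, Nat.cast_mul, hGcard]
  have hK0 : (0 : ℝ) < K := by exact_mod_cast hK1
  have hn0 : (0 : ℝ) < n₁ := by exact_mod_cast (by omega : 0 < n₁)
  have hm0 : 0 < (K : ℝ) ^ D * n₁ * p := by positivity
  set O : (Fin D → ℕ) → (Fin D → ℕ) → ℝ := fun v v' => Real.exp (lam * Real.exp
    (b - ∑ j, max (gridPoint b h v j) (gridPoint b h v' j))) with hO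
  have hpair : ∀ a ∈ S, ∀ a' ∈ S, P.real (E a ∩ E a') ≤
      (if a = a' then p else 0) + p ^ 2 * ((1 - q) ^ 2)⁻¹ * O a.1 a'.1 := by
    intro a ha a' ha'
    have hOpos : 0 ≤ p ^ 2 * ((1 - q) ^ 2)⁻¹ * O a.1 a'.1 := by
      have := (Real.exp_pos (lam * Real.exp
        (b - ∑ j, max (gridPoint b h a.1 j) (gridPoint b h a'.1 j)))).le
      positivity
    by_cases haa : a = a'
    · subst haa
      rw [if_pos rfl, Set.inter_self, hEp a ha]
      linarith
    rw [if_neg haa, zero_add]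
    obtain ⟨h1, h2⟩ := Finset.mem_product.1 ha
    obtain ⟨h1', h2'⟩ := Finset.mem_product.1 ha'
    -- One point cannot lie in two boxes of different grid index, so distinct pairs with the same
    -- sample index are disjoint events.
    by_cases hi : a.2 = a'.2
    · have hv : a.1 ≠ a'.1 := fun hv => haa (Prod.ext hv hi)
      obtain ⟨j, hj⟩ := Function.ne_iff.1 hv
      have : E a ∩ E a' = ∅ := by
        refine Set.eq_empty_of_forall_notMem fun ω hω => hj ?_
        obtain ⟨hω1, hω2⟩ := hω
        rw [hE] at hω1 hω2
        have e1 := ((mem_soleInOrthant (hlt _ h2)).1 hω1).1 j.succ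
        have e2 := ((mem_soleInOrthant (hlt _ h2')).1 hω2).1 j.succ
        rw [← hi] at e2
        simp only [gridPoint, Fin.cons_succ] at e1 e2
        have l1 : h * a.1 j < h * (a'.1 j + 1) := by linarith
        have l2 : h * a'.1 j < h * (a.1 j + 1) := by linarith
        have l1 := lt_of_mul_lt_mul_left l1 hh.le
        have l2 := lt_of_mul_lt_mul_left l2 hh.le
        have l1 : a.1 j < a'.1 j + 1 := by exact_mod_cast l1
        have l2 : a'.1 j < a.1 j + 1 := by exact_mod_cast l2
        omega
      rw [this]
      simpa using hOpos
    · refine (measureReal_inter_soleInOrthant_le hmeas hindep hlaw hh.le (hgn _ h1) (hgn _ h1')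
        (hlt _ h2) (hlt _ h2') hi).trans ?_
      rw [sum_gridPoint, sum_gridPoint]
      set e := Real.exp (b - ∑ j, max (gridPoint b h a.1 j) (gridPoint b h a'.1 j)) with he
      have hmax : Real.exp (-∑ j, max (gridPoint b h a.1 j) (gridPoint b h a'.1 j)) = q * e := by
        rw [hq, he, ← Real.exp_add]
        congr 1
        ring
      have hov := overlap_pow_le hq0.le hb (Real.exp_pos _ : 0 < e).le (hn₁.trans hn)
      rw [hmax, ← hq, ← hw]
      calc _ = (q * w) * (q * w) * (1 - 2 * q + q * e) ^ (n₂ - 2) := by ring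
        _ ≤ (q * w) * (q * w) * ((1 - q) ^ (2 * (n₂ - 1)) *
              (((1 - q) ^ 2)⁻¹ * Real.exp (n₂ * q / (1 - q) ^ 2 * e))) := by gcongr
        _ = _ := by
          simp only [hO, hp]
          rw [pow_mul']
          ring
  set B := (2 * ρ + 1 : ℝ) ^ D * Real.exp lam +
    (2 * R + 1) ^ D * Real.exp (lam * Real.exp (-(h * (ρ + 1))))
    + K ^ D * Real.exp (lam * Real.exp (-(h * (R + 1)))) with hB
  have hdouble : ∑ a ∈ S, ∑ a' ∈ S, P.real (E a ∩ E a') ≤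
      K ^ D * n₁ * p + p ^ 2 * ((1 - q) ^ 2)⁻¹ * (n₁ ^ 2 * (K ^ D * B)) := by
    refine (Finset.sum_le_sum fun a ha => Finset.sum_le_sum fun a' ha' => hpair a ha a' ha').trans ?_
    simp only [Finset.sum_add_distrib, ← Finset.mul_sum]
    refine add_le_add (le_of_eq ?_) ?_
    · rw [← hsum]
      refine Finset.sum_congr rfl fun a ha => ?_
      rw [Finset.sum_ite_eq, if_pos ha, hEp a ha]
    · refine mul_le_mul_of_nonneg_left ?_ (by positivity)
      have e1 : ∀ v, ∑ a' ∈ S, O v a'.1 = n₁ * ∑ v' ∈ G, O v v' := by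
        intro v
        rw [hS, Finset.sum_product]
        simp [Finset.mul_sum]
      simp only [e1]
      rw [← Finset.mul_sum, hS, Finset.sum_product]
      simp only [Finset.sum_const, Finset.card_range, nsmul_eq_mul]
      rw [← Finset.mul_sum, ← mul_assoc, ← sq, ← hGcard, ← nsmul_eq_mul G.card]
      refine mul_le_mul_of_nonneg_left (Finset.sum_le_card_nsmul _ _ _ fun v _ => ?_) (by positivity)
      rw [hB, ← hGcard]
      exact sum_exp_overlap_le hh.le hlam0 G ρ R v
  -- A dominator of a point of the box at g would lie in the orthant above g, so a sole point there
  -- is undominated; leaving the corner raises the sum by at most (D + 1) h.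
  have hsub : {ω | ¬ ∃ i < n₁, ∑ j, X i ω j ≤ b + (D + 1) * h ∧
      ∀ l < n₂, ¬ ∀ j, X i ω j < X l ω j} ⊆ ⋂ a ∈ S, (E a)ᶜ := by
    intro ω hω
    refine Set.mem_iInter₂.2 fun a ha hEa => hω ?_
    obtain ⟨h1, h2⟩ := Finset.mem_product.1 ha
    obtain ⟨hbox, hsole⟩ := (mem_soleInOrthant (hlt _ h2)).1 hEa
    refine ⟨a.2, Finset.mem_range.1 h2, ?_, fun l hl hdom => ?_⟩
    · refine (Finset.sum_le_sum fun j _ => (hbox j).2.le).trans (le_of_eq ?_)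
      rw [Finset.sum_add_distrib, sum_gridPoint]
      simp
    · by_cases hla : l = a.2
      · rw [hla] at hdom
        exact lt_irrefl _ (hdom 0)
      · exact hsole l hl hla fun j => (hbox j).1.trans (hdom j).le
  refine (measureReal_mono hsub).trans ?_
  refine (measureReal_biInter_compl_le S (fun a => measurableSet_soleInOrthant hmeas _ _ _ _)
    (by rw [hsum]; exact hm0)).trans ?_
  rw [hsum]
  refine sub_le_sub_right ((div_le_div_of_nonneg_right hdouble (by positivity)).trans
    (le_of_eq ?_)) 1
  rw [hB, div_pow, div_pow]
  have h1q := (sub_pos.2 hq1).ne'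
  field_simp

theorem exp_neg_div_le_one_sub {q : ℝ} (hq : q < 1) : Real.exp (-(q / (1 - q))) ≤ 1 - q := by
  have h1 : 0 < 1 - q := by linarith
  have h2 := Real.add_one_le_exp (q / (1 - q))
  have h3 : q / (1 - q) + 1 = (1 - q)⁻¹ := by field_simp; ring
  rw [Real.exp_neg]
  exact inv_le_of_inv_le₀ h1 (h3 ▸ h2)

/-- The second moment bound, with `e ^ (-b) = q`, in a form without powers of `1 - q`. -/
theorem measureReal_not_exists_undominated_le_of_small {Ω : Type*} [MeasurableSpace Ω]
    {P : Measure Ω} [IsProbabilityMeasure P] {D : ℕ} {X : ℕ → Ω → Fin (D + 1) → ℝ}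
    (hmeas : ∀ i, Measurable (X i)) (hindep : iIndepFun X P)
    (hlaw : ∀ i, P.map (X i) = expLaw (D + 1)) {q h : ℝ} (hq0 : 0 < q) (hq : q ≤ 1 / 2)
    (hh : 0 < h) {K : ℕ} (hK1 : 1 ≤ K) (hK : h * K * D ≤ -Real.log q) {n₁ n₂ : ℕ} (hn₁ : 2 ≤ n₁)
    (hn : n₁ ≤ n₂) (ρ R : ℕ) {t : ℝ} (ht : t = n₂ * q) (htq : 6 * t * q ≤ 1)
    (hfar : 4 * q + 4 * (t * Real.exp (-(h * (R + 1)))) ≤ 1) :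
    P.real {ω | ¬ ∃ i < n₁, ∑ j, X i ω j ≤ -Real.log q + (D + 1) * h ∧
        ∀ l < n₂, ¬ ∀ j, X i ω j < X l ω j} ≤
      Real.exp (t + 1) / (K ^ D * (n₁ * q) * (1 - Real.exp (-h)) ^ (D + 1))
        + 4 * ((2 * ρ + 1) / K) ^ D * Real.exp (t + 1)
        + 4 * ((2 * R + 1) / K) ^ D * Real.exp ((t + 1) * Real.exp (-(h * (ρ + 1))))
        + 8 * (q + t * Real.exp (-(h * (R + 1)))) := by
  have hlog : Real.exp (-(-Real.log q)) = q := by rw [neg_neg, Real.exp_log hq0]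
  have hmain := measureReal_not_exists_undominated_le hmeas hindep hlaw (b := -Real.log q)
    (by rwa [hlog]) hh hK1 hK hn₁ hn ρ R
  rw [hlog, ← ht] at hmain
  refine hmain.trans ?_
  have h1q : 0 < 1 - q := by linarith
  have ht0 : 0 ≤ t := by rw [ht]; positivity
  have hn₁' : (0 : ℝ) < n₁ := by exact_mod_cast (by omega : 0 < n₁)
  have hK0 : (0 : ℝ) < K := by exact_mod_cast hK1
  have hw : 0 < 1 - Real.exp (-h) := sub_pos.2 (Real.exp_lt_one_iff.2 (by linarith))
  have hinv : ((1 - q) ^ 2)⁻¹ ≤ 1 + 6 * q := by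
    rw [inv_le_iff_one_le_mul₀ (by positivity)]
    nlinarith [mul_nonneg hq0.le (sub_nonneg.2 hq), sq_nonneg q]
  have hinv4 : ((1 - q) ^ 2)⁻¹ ≤ 4 := by linarith
  have hinve : ((1 - q) ^ 2)⁻¹ ≤ Real.exp (4 * q) := by
    rw [inv_le_comm₀ (by positivity) (Real.exp_pos _), ← Real.exp_neg]
    have h1 := exp_neg_div_le_one_sub (q := q) (by linarith)
    have h2 : -(2 * q) ≤ -(q / (1 - q)) := by
      refine neg_le_neg ?_
      rw [div_le_iff₀ h1q]
      nlinarith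
    have h3 := (Real.exp_le_exp.2 h2).trans h1
    calc Real.exp (-(4 * q)) = Real.exp (-(2 * q)) ^ 2 := by
          rw [← Real.exp_nat_mul]; congr 1; push_cast; ring
      _ ≤ _ := pow_le_pow_left₀ (Real.exp_pos _).le h3 2
  -- By `hinv` the left side is at most t + 6 t q, and `htq` bounds the excess by 1.
  have hlam : t / (1 - q) ^ 2 ≤ t + 1 := by
    rw [div_eq_mul_inv]
    nlinarith [mul_le_mul_of_nonneg_left hinv ht0]
  have hlam4 : t / (1 - q) ^ 2 ≤ 4 * t := by
    rw [div_eq_mul_inv, mul_comm]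
    exact mul_le_mul_of_nonneg_right hinv4 ht0
  have hpow : Real.exp (-(t + 1)) ≤ (1 - q) ^ (n₂ - 1) := by
    have h1 := exp_neg_div_le_one_sub (q := q) (by linarith)
    calc Real.exp (-(t + 1)) ≤ Real.exp (-(q / (1 - q))) ^ n₂ := by
          rw [← Real.exp_nat_mul]
          refine Real.exp_le_exp.2 ?_
          have h2 : q / (1 - q) ≤ q + 2 * q * q := by
            rw [div_le_iff₀ h1q]
            nlinarith [mul_nonneg hq0.le (sub_nonneg.2 hq), sq_nonneg q, mul_pos hq0 hq0,
              mul_nonneg (mul_pos hq0 hq0).le (sub_nonneg.2 hq)]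
          have h3 : (n₂ : ℝ) * (q / (1 - q)) ≤ n₂ * (q + 2 * q * q) := by gcongr
          have h4 : (n₂ : ℝ) * (q + 2 * q * q) = t + 2 * t * q := by rw [ht]; ring
          have h5 : 0 ≤ t * q := by positivity
          linarith
      _ ≤ (1 - q) ^ n₂ := pow_le_pow_left₀ (Real.exp_pos _).le h1 _
      _ ≤ _ := pow_le_pow_of_le_one h1q.le (by linarith) (Nat.sub_le _ _)
  have hT1 : (K ^ D * n₁ * (q * (1 - Real.exp (-h)) ^ (D + 1) * (1 - q) ^ (n₂ - 1)))⁻¹ ≤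
      Real.exp (t + 1) / (K ^ D * (n₁ * q) * (1 - Real.exp (-h)) ^ (D + 1)) := by
    have h1 : (K ^ D * n₁ * (q * (1 - Real.exp (-h)) ^ (D + 1) * (1 - q) ^ (n₂ - 1)))⁻¹ =
        ((1 - q) ^ (n₂ - 1))⁻¹ / (K ^ D * (n₁ * q) * (1 - Real.exp (-h)) ^ (D + 1)) := by
      field_simp
    rw [h1]
    refine div_le_div_of_nonneg_right ?_ (by positivity)
    rw [inv_le_comm₀ (by positivity) (Real.exp_pos _), ← Real.exp_neg]
    exact hpow
  -- The far zone carries the bulk of the pairs, so its term is close to 1 and absorbs the -1 of the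
  -- variance. The hypothesis `hfar` gives x ≤ 1, where e^x - 1 ≤ 2x.
  have hT4 : ((1 - q) ^ 2)⁻¹ * Real.exp (t / (1 - q) ^ 2 * Real.exp (-(h * (R + 1)))) - 1 ≤
      8 * (q + t * Real.exp (-(h * (R + 1)))) := by
    set x := 4 * q + 4 * (t * Real.exp (-(h * (R + 1)))) with hx
    have hx0 : 0 ≤ x := by positivity
    have h1 : ((1 - q) ^ 2)⁻¹ * Real.exp (t / (1 - q) ^ 2 * Real.exp (-(h * (R + 1)))) ≤
        Real.exp x := by
      rw [hx, Real.exp_add, ← mul_assoc]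
      gcongr
    have h2 := Real.abs_exp_sub_one_le (x := x) (by rwa [abs_of_nonneg hx0])
    rw [abs_of_nonneg hx0] at h2
    have := le_abs_self (Real.exp x - 1)
    linarith
  have hT2 : ((1 - q) ^ 2)⁻¹ * (((2 * ρ + 1) / K) ^ D * Real.exp (t / (1 - q) ^ 2)) ≤
      4 * ((2 * ρ + 1) / K) ^ D * Real.exp (t + 1) := by
    rw [mul_assoc 4]
    gcongr
  have hT3 : ((1 - q) ^ 2)⁻¹ * (((2 * R + 1) / K) ^ D *
      Real.exp (t / (1 - q) ^ 2 * Real.exp (-(h * (ρ + 1))))) ≤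
      4 * ((2 * R + 1) / K) ^ D * Real.exp ((t + 1) * Real.exp (-(h * (ρ + 1)))) := by
    rw [mul_assoc 4]
    gcongr
  rw [mul_add, mul_add]
  linarith

/-! ### Records as undominated points, and growth of iterated logarithms -/

section

variable {d : ℕ}

theorem exists_undominated_of_minRecordSum_le (hd : 1 ≤ d) {x : ℕ → Fin d → ℝ} {n : ℕ} (hn : 1 ≤ n)
    {b : ℝ} (h : minRecordSum x n ≤ b) :
    ∃ i < n, ∑ j, x i j ≤ b ∧ ∀ l < n, ¬ ∀ j, x i j < x l j := by
  obtain ⟨k, hk, hs⟩ := (isLeast_minRecordSum hd x hn).1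
  exact ⟨k, hk.1, hs ▸ h, hk.2⟩

theorem minRecordSum_le_of_undominated (hd : 1 ≤ d) {x : ℕ → Fin d → ℝ} {n i : ℕ} (hi : i < n)
    {b : ℝ} (hs : ∑ j, x i j ≤ b) (h : ∀ l < n, ¬ ∀ j, x i j < x l j) : minRecordSum x n ≤ b :=
  ((isLeast_minRecordSum hd x (by omega)).2 ⟨i, ⟨hi, h⟩, rfl⟩).trans hs

end

theorem eventually_mul_log_log_le (c : ℝ) :
    ∀ᶠ n : ℕ in atTop, c * Real.log (Real.log n) ≤ Real.log n := by
  have h := (Real.isLittleO_log_id_atTop.comp_tendsto Real.tendsto_log_atTop).comp_tendsto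
    tendsto_natCast_atTop_atTop
  have hc : (0 : ℝ) < (|c| + 1)⁻¹ := by positivity
  filter_upwards [h.bound hc, (Real.tendsto_log_atTop.comp Real.tendsto_log_atTop).comp
      tendsto_natCast_atTop_atTop |>.eventually_ge_atTop 0,
    (Real.tendsto_log_atTop.comp tendsto_natCast_atTop_atTop).eventually_ge_atTop 0]
    with n hn h0 h1
  simp only [Function.comp_apply, id, Real.norm_eq_abs] at hn h0 h1
  rw [abs_of_nonneg h0, abs_of_nonneg h1, inv_mul_eq_div, le_div_iff₀ (by positivity)] at hn
  nlinarith [le_abs_self c]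

theorem tendsto_log_log_atTop : Tendsto (fun n : ℕ => Real.log (Real.log n)) atTop atTop :=
  (Real.tendsto_log_atTop.comp Real.tendsto_log_atTop).comp tendsto_natCast_atTop_atTop

/-! ### Estimates at a single time, for (a) -/

/-- The choice of b makes n e^{-b} = D l e^{M/l} ≥ D (l + M). The factor e^{-D l} = L^{-D} cancels
b^D ≤ L^D and leaves e^{-D M}. -/
theorem firstMoment_at_lower_le {D : ℕ} (hD : 1 ≤ D) {M : ℝ} (hM : 0 ≤ M) {n : ℕ} {L l b : ℝ}
    (hL : L = Real.log n) (hl : l = Real.log L)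
    (hb : b = Real.log n - Real.log l - Real.log D - M / l) (hl1 : 1 ≤ l) (hlM : M ≤ l)
    (hlL : 3 * D * l ≤ L) :
    0 ≤ b ∧ n / ((n : ℝ) - 1) * b ^ D * Real.exp (-((n - 1) * Real.exp (-b))) ≤
      2 * Real.exp 1 * Real.exp (-M) := by
  have hD1 : (1 : ℝ) ≤ D := by exact_mod_cast hD
  have hL3 : 3 ≤ L := by nlinarith
  have hn0 : (0 : ℝ) < n := by
    rcases Nat.eq_zero_or_pos n with rfl | h
    · simp at hL; linarith
    · exact_mod_cast h
  have hnL : L ≤ n := by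
    have := Real.log_le_sub_one_of_pos hn0
    linarith
  have hl0 : 0 < l := by linarith
  have hu : M / l ≤ 1 := (div_le_one hl0).2 hlM
  have hu0 : 0 ≤ M / l := by positivity
  have hexpb : Real.exp (-b) = D * l * Real.exp (M / l) / n := by
    have : -b = Real.log D + Real.log l + M / l - Real.log n := by rw [hb]; ring
    rw [this, Real.exp_sub, Real.exp_add, Real.exp_add, Real.exp_log hn0, Real.exp_log hl0,
      Real.exp_log (by linarith)]
  have hexp3 : Real.exp (M / l) ≤ 3 :=
    (Real.exp_le_exp.2 hu).trans (Real.exp_one_lt_d9.le.trans (by norm_num))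
  have hDl : 0 < D * l := by positivity
  have hsmall : Real.exp (-b) ≤ 1 := by
    rw [hexpb, div_le_one hn0]
    nlinarith
  have hb0 : 0 ≤ b := by
    have := Real.exp_le_one_iff.1 hsmall
    linarith
  refine ⟨hb0, ?_⟩
  have hbL : b ≤ L := by
    have h1 : 0 ≤ Real.log l := Real.log_nonneg hl1
    have h2 : 0 ≤ Real.log D := Real.log_nonneg hD1
    rw [hb, hL]; linarith
  have hmain : D * (l + M) - 1 ≤ (n - 1) * Real.exp (-b) := by
    have h1 : (n : ℝ) * Real.exp (-b) = D * l * Real.exp (M / l) := by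
      rw [hexpb]; field_simp
    have h2 : D * l * (M / l + 1) ≤ D * l * Real.exp (M / l) :=
      mul_le_mul_of_nonneg_left (Real.add_one_le_exp _) hDl.le
    have h3 : D * l * (M / l + 1) = D * (l + M) := by field_simp; ring
    linarith
  have hfrac : (n : ℝ) / (n - 1) ≤ 2 := by
    rw [div_le_iff₀ (by linarith)]
    linarith
  have hLpow : L ^ D = Real.exp (D * l) := by
    rw [Real.exp_nat_mul, hl, Real.exp_log (by linarith)]
  calc (n : ℝ) / (n - 1) * b ^ D * Real.exp (-((n - 1) * Real.exp (-b)))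
      ≤ 2 * L ^ D * Real.exp (-(D * (l + M) - 1)) := by gcongr
    _ = 2 * (Real.exp 1 * Real.exp (-(D * M))) := by
        rw [hLpow, mul_assoc, ← Real.exp_add, ← Real.exp_add]
        congr 2
        ring
    _ ≤ 2 * (Real.exp 1 * Real.exp (-M)) := by
        gcongr
        nlinarith
    _ = _ := by ring

/-- The part of the second moment bound that vanishes as `l = log log n → ∞`. -/
noncomputable def overlapError (D : ℕ) (l : ℝ) : ℝ :=
  4 * Real.exp 1 * (12 * D * (l * Real.exp (-(1 / 2 * l)))) ^ D + 16 * D * (l * Real.exp (-l))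

theorem tendsto_overlapError {D : ℕ} (hD : 1 ≤ D) :
    Tendsto (overlapError D) atTop (nhds 0) := by
  have h : ∀ c : ℝ, 0 < c → Tendsto (fun l : ℝ => l * Real.exp (-(c * l))) atTop (nhds 0) := by
    intro c hc
    have := Real.tendsto_pow_mul_exp_neg_atTop_nhds_zero 1
    have h2 := (this.comp (tendsto_id.const_mul_atTop hc)).const_mul c⁻¹
    rw [mul_zero] at h2
    refine h2.congr fun l => ?_
    simp only [Function.comp_apply, id, pow_one]
    field_simp
  have h1 := ((((h (1 / 2) (by norm_num)).const_mul (12 * D : ℝ)).pow D).const_mul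
    (4 * Real.exp 1)).add ((h 1 one_pos).const_mul (16 * D : ℝ))
  simp only [one_mul, mul_zero, zero_pow (by omega : D ≠ 0), add_zero] at h1
  exact h1

/-- The constant in the part of the second moment bound that does not vanish. -/
noncomputable def overlapConst (D : ℕ) : ℝ :=
  4 * Real.exp 1 * (8 * D) ^ D + 4 * Real.exp 1 * (12 * D) ^ D

theorem half_le_one_sub_exp_neg {h : ℝ} (h0 : 0 ≤ h) (h1 : h ≤ 1) :
    h / 2 ≤ 1 - Real.exp (-h) := by
  have h2 := Real.add_one_le_exp h
  have h3 : Real.exp (-h) ≤ (h + 1)⁻¹ := by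
    rw [Real.exp_neg]
    exact inv_anti₀ (by linarith) h2
  have h4 : (h + 1)⁻¹ ≤ 1 - h / 2 := by
    rw [inv_le_iff_one_le_mul₀ (by linarith)]
    nlinarith
  linarith

-- Here h = 1/l, so the box overshoot (D + 1)/l is of the precision claimed in (a). With n q = t = D
-- (l - M), e^t = L^D e^{-D M}, while K is of order L l. The diagonal and near terms are then
-- O(e^{-D M}), the middle term is O((l e^{-l/2})^D), and the far term is O(l e^{-l}).
set_option maxHeartbeats 800000 in
theorem measureReal_not_exists_undominated_upper_le {Ω : Type*} [MeasurableSpace Ω] {P : Measure Ω}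
    [IsProbabilityMeasure P] {D : ℕ} (hD : 1 ≤ D) {X : ℕ → Ω → Fin (D + 1) → ℝ}
    (hmeas : ∀ i, Measurable (X i)) (hindep : iIndepFun X P)
    (hlaw : ∀ i, P.map (X i) = expLaw (D + 1)) {M : ℝ} (hM : 0 ≤ M) {n : ℕ} {L l : ℝ}
    (hL : L = Real.log n) (hl : l = Real.log L) (hl3 : 3 ≤ l) (hlM : 2 * M ≤ l)
    (hlL : 8 * D * l ≤ L) :
    P.real {ω | ¬ ∃ i < n, ∑ j, X i ω j ≤ -Real.log (D * (l - M) / n) + (D + 1) * (1 / l) ∧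
        ∀ l < n, ¬ ∀ j, X i ω j < X l ω j} ≤
      overlapConst D * Real.exp (-M) + overlapError D l := by
  have hD1 : (1 : ℝ) ≤ D := by exact_mod_cast hD
  have hDl : 3 ≤ D * l := by nlinarith
  have hL16 : 16 ≤ L := by nlinarith
  have hL0 : 0 < L := by linarith
  have hn0 : (0 : ℝ) < n := by
    rcases Nat.eq_zero_or_pos n with rfl | h
    · simp at hL; linarith
    · exact_mod_cast h
  have hnL : L ≤ n := by
    have := Real.log_le_sub_one_of_pos hn0
    linarith
  have hnL2 : L ^ 2 / 2 ≤ n := by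
    have h1 := Real.quadratic_le_exp_of_nonneg hL0.le
    rw [hL, Real.exp_log hn0, ← hL] at h1
    nlinarith
  have hexpl : Real.exp l = L := by rw [hl, Real.exp_log hL0]
  have hexpnl : Real.exp (-l) = L⁻¹ := by rw [Real.exp_neg, hexpl]
  have hl0 : 0 < l := by linarith
  set q := D * (l - M) / n with hq
  set t := D * (l - M) with ht
  have ht0 : 0 < t := by
    have : 0 < l - M := by linarith
    positivity
  have htDl : t ≤ D * l := by rw [ht]; gcongr; linarith
  have hthalf : D * l / 2 ≤ t := by
    have : D * (2 * M) ≤ D * l := by gcongr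
    rw [ht]
    linarith
  have hq0 : 0 < q := by positivity
  have htn : t = n * q := by rw [hq]; field_simp
  have hqL : q ≤ D * l / L := div_le_div₀ (by positivity) htDl hL0 hnL
  have hDlL : D * l / L ≤ 1 / 8 := by rw [div_le_iff₀ hL0]; linarith
  have htq : 6 * t * q ≤ 1 := by
    have h1 : 6 * t * q = 6 * t * t / n := by rw [hq]; ring
    rw [h1, div_le_one hn0]
    have h2 : t * t ≤ (D * l) * (D * l) := by gcongr
    have h3 : (8 * D * l) * (8 * D * l) ≤ L * L := by gcongr
    have h4 : 0 ≤ (D * l) * (D * l) := by positivity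
    linarith
  set b := -Real.log q with hb
  have hbL : L / 2 ≤ b := by
    have h1 : Real.log q = Real.log t - L := by
      rw [hq, Real.log_div ht0.ne' hn0.ne', hL]
    have h2 := Real.log_le_sub_one_of_pos ht0
    rw [hb, h1]
    linarith
  have hb0 : 0 < b := by linarith
  set K := ⌊b * l / D⌋₊ with hKdef
  have hKle : (K : ℝ) ≤ b * l / D := Nat.floor_le (by positivity)
  have hKge : L * l / (4 * D) ≤ K := by
    have h1 := Nat.lt_floor_add_one (b * l / D)
    have h2 : L / 2 * l / D ≤ b * l / D := by gcongr
    have h3 : 1 ≤ L * l / (4 * D) := by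
      rw [le_div_iff₀ (by positivity)]
      have h5 := mul_le_mul_of_nonneg_left hl3 (by linarith : (0 : ℝ) ≤ D)
      have h6 := mul_le_mul_of_nonneg_left hl3 hL0.le
      linarith
    have h4 : L / 2 * l / D = 2 * (L * l / (4 * D)) := by field_simp; ring
    rw [← hKdef] at h1
    linarith
  have hKpos : 0 < L * l / (4 * D) := by positivity
  have hK0 : (0 : ℝ) < K := hKpos.trans_le hKge
  have hK1 : 1 ≤ K := by exact_mod_cast hK0
  have hKD : 1 / l * K * D ≤ b := by
    calc 1 / l * K * D ≤ 1 / l * (b * l / D) * D := by gcongr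
      _ = b := by field_simp
  -- At mesh 1/l, radius ρ is a distance of at least 1, with overlap at most 1/2, and radius R is a
  -- distance of at least l, with overlap at most 1/L.
  set ρ := ⌈l⌉₊ with hρ
  set R := ⌈l ^ 2⌉₊ with hR
  have hρl : l ≤ ρ := Nat.le_ceil _
  have hRl : l ^ 2 ≤ R := Nat.le_ceil _
  have hρu : (2 * ρ + 1 : ℝ) ≤ 3 * l := by
    have := Nat.ceil_lt_add_one hl0.le
    rw [← hρ] at this
    linarith
  have hRu : (2 * R + 1 : ℝ) ≤ 3 * l ^ 2 := by
    have := Nat.ceil_lt_add_one (sq_nonneg l)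
    rw [← hR] at this
    have h9 : 3 * 3 ≤ l * l := by gcongr
    linarith
  have hfarR : Real.exp (-(1 / l * (R + 1))) ≤ L⁻¹ := by
    rw [← hexpnl]
    refine Real.exp_le_exp.2 (neg_le_neg ?_)
    rw [one_div, inv_mul_eq_div, le_div_iff₀ hl0]
    linarith
  have hfarρ : Real.exp (-(1 / l * (ρ + 1))) ≤ 1 / 2 := by
    have h1 : Real.exp (-(1 / l * (ρ + 1))) ≤ Real.exp (-1) := by
      refine Real.exp_le_exp.2 (neg_le_neg ?_)
      rw [one_div, inv_mul_eq_div, le_div_iff₀ hl0]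
      linarith
    refine h1.trans ?_
    rw [Real.exp_neg, one_div]
    exact inv_anti₀ two_pos (by linarith [Real.add_one_le_exp (1 : ℝ)])
  have htfar : t * Real.exp (-(1 / l * (R + 1))) ≤ D * l * L⁻¹ :=
     mul_le_mul htDl hfarR (Real.exp_pos _).le (by positivity)
  have hn2 : 2 ≤ n := by
    have : (2 : ℝ) ≤ n := by linarith
    exact_mod_cast this
  refine (measureReal_not_exists_undominated_le_of_small hmeas hindep hlaw hq0 (by linarith)
    (by positivity : 0 < 1 / l) hK1 hKD hn2 le_rfl ρ R htn htq
    (by rw [div_eq_mul_inv] at hqL hDlL; linarith)).trans ?_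
  rw [← htn]
  have hexpt : Real.exp (t + 1) = L ^ D * Real.exp 1 * Real.exp (-(D * M)) := by
    rw [← hexpl, ← Real.exp_nat_mul, ← Real.exp_add, ← Real.exp_add]
    congr 1
    rw [ht]
    ring
  have hexpM : Real.exp (-(D * M)) ≤ Real.exp (-M) := by
    refine Real.exp_le_exp.2 (neg_le_neg ?_)
    exact le_mul_of_one_le_left hM hD1
  have hw : 1 / (2 * l) ≤ 1 - Real.exp (-(1 / l)) := by
    have := half_le_one_sub_exp_neg (h := 1 / l) (by positivity)
      ((div_le_one hl0).2 (by linarith))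
    calc 1 / (2 * l) = 1 / l / 2 := by field_simp
      _ ≤ _ := this
  have hT1 : Real.exp (t + 1) / (K ^ D * t * (1 - Real.exp (-(1 / l))) ^ (D + 1)) ≤
      4 * Real.exp 1 * (8 * D) ^ D * Real.exp (-M) := by
    calc Real.exp (t + 1) / (K ^ D * t * (1 - Real.exp (-(1 / l))) ^ (D + 1))
        ≤ Real.exp (t + 1) / ((L * l / (4 * D)) ^ D * (D * l / 2) * (1 / (2 * l)) ^ (D + 1)) := by
          gcongr
      _ = 4 * Real.exp 1 * (8 * D) ^ D * Real.exp (-(D * M)) * (D : ℝ)⁻¹ := by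
          have h1 : (L * l / (4 * D)) ^ D * (D * l / 2) * (1 / (2 * l)) ^ (D + 1) =
              (L / (8 * D)) ^ D * (D / 4) := by
            have h2 : L / (8 * D) = L * l / (4 * D) * (1 / (2 * l)) := by field_simp; ring
            rw [h2, mul_pow, pow_succ]
            field_simp
            ring
          have h3 : L ^ D = (L / (8 * D)) ^ D * (8 * D) ^ D := by
            rw [← mul_pow]; congr 1; field_simp
          rw [hexpt, h1, h3]
          field_simp
      _ ≤ 4 * Real.exp 1 * (8 * D) ^ D * Real.exp (-(D * M)) * 1 := by
          gcongr
          exact inv_le_one_of_one_le₀ hD1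
      _ ≤ _ := by rw [mul_one]; gcongr
  have hT2 : 4 * ((2 * ρ + 1) / K) ^ D * Real.exp (t + 1) ≤
      4 * Real.exp 1 * (12 * D) ^ D * Real.exp (-M) := by
    calc 4 * ((2 * ρ + 1) / K) ^ D * Real.exp (t + 1)
        ≤ 4 * (3 * l / (L * l / (4 * D))) ^ D * Real.exp (t + 1) := by gcongr
      _ = 4 * Real.exp 1 * (12 * D) ^ D * Real.exp (-(D * M)) := by
          have h1 : 12 * D = 3 * l / (L * l / (4 * D)) * L := by field_simp; ring
          rw [h1, mul_pow, hexpt]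
          ring
      _ ≤ _ := by gcongr
  have hT3 : 4 * ((2 * R + 1) / K) ^ D * Real.exp ((t + 1) * Real.exp (-(1 / l * (ρ + 1)))) ≤
      4 * Real.exp 1 * (12 * D * (l * Real.exp (-(1 / 2 * l)))) ^ D := by
    have h1 : Real.exp ((t + 1) * Real.exp (-(1 / l * (ρ + 1)))) ≤
        Real.exp 1 * Real.exp (1 / 2 * l) ^ D := by
      rw [← Real.exp_nat_mul, ← Real.exp_add]
      refine Real.exp_le_exp.2 ?_
      calc (t + 1) * Real.exp (-(1 / l * (ρ + 1))) ≤ (D * l + 1) * (1 / 2) := by gcongr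
        _ ≤ _ := by linarith
    calc _ ≤ 4 * (3 * l ^ 2 / (L * l / (4 * D))) ^ D * (Real.exp 1 * Real.exp (1 / 2 * l) ^ D) := by
          gcongr
      _ = _ := by
          have h2 : Real.exp (-(1 / 2 * l)) = Real.exp (1 / 2 * l) / L := by
            rw [← hexpl, ← Real.exp_sub]; congr 1; ring
          have h3 : 12 * D * (l * Real.exp (-(1 / 2 * l))) =
              3 * l ^ 2 / (L * l / (4 * D)) * Real.exp (1 / 2 * l) := by
            rw [h2]; field_simp; ring
          rw [h3, mul_pow]
          ring
  have hT4 : 8 * (q + t * Real.exp (-(1 / l * (R + 1)))) ≤ 16 * D * (l * Real.exp (-l)) := by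
    rw [hexpnl]
    rw [div_eq_mul_inv] at hqL
    linarith
  rw [overlapConst, overlapError]
  linarith

/-! ### Dyadic blocks and Borel–Cantelli, for (b) and (c) -/

/-- The Borel–Cantelli lemma along dyadic blocks. -/
theorem measure_frequently_eq_zero_of_dyadic {Ω : Type*} [MeasurableSpace Ω] {P : Measure Ω}
    {p : ℕ → Ω → Prop} {u : ℕ → ℝ} (hu : Summable u)
    (h : ∀ᶠ k in atTop, P {ω | ∃ n, 2 ^ k ≤ n ∧ n < 2 ^ (k + 1) ∧ p n ω} ≤ ENNReal.ofReal (u k)) :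
    P {ω | ∃ᶠ n in atTop, p n ω} = 0 := by
  obtain ⟨k₀, hk₀⟩ := eventually_atTop.1 h
  have hlim : P {ω | ∃ᶠ k in atTop, k₀ ≤ k ∧ ∃ n, 2 ^ k ≤ n ∧ n < 2 ^ (k + 1) ∧ p n ω} = 0 := by
    refine measure_setOfPred_frequently_eq_zero (ne_top_of_le_ne_top hu.tsum_ofReal_ne_top
      (ENNReal.tsum_le_tsum fun k => ?_))
    by_cases hk : k₀ ≤ k
    · simpa [hk] using hk₀ k hk
    · simp [hk]
  refine measure_mono_null (fun ω hω => ?_) hlim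
  refine frequently_atTop.2 fun a => ?_
  obtain ⟨n, hn, hp⟩ := frequently_atTop.1 hω (2 ^ max a k₀)
  have hn0 : n ≠ 0 := by
    have := Nat.two_pow_pos (max a k₀)
    omega
  have hk : max a k₀ ≤ Nat.log 2 n := Nat.le_log_of_pow_le one_lt_two hn
  exact ⟨Nat.log 2 n, (le_max_left _ _).trans hk, (le_max_right _ _).trans hk, n,
    Nat.pow_log_le_self 2 hn0, Nat.lt_pow_succ_log_self one_lt_two n, hp⟩

theorem log_bounds_of_dyadic {k n : ℕ} (h1 : 2 ^ k ≤ n) (h2 : n < 2 ^ (k + 1)) :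
    k * Real.log 2 ≤ Real.log n ∧ Real.log n ≤ (k + 1) * Real.log 2 := by
  have e1 : ((2 ^ k : ℕ) : ℝ) ≤ n := by exact_mod_cast h1
  have e2 : (n : ℝ) ≤ ((2 ^ (k + 1) : ℕ) : ℝ) := by exact_mod_cast h2.le
  have h0 : (0 : ℝ) < ((2 ^ k : ℕ) : ℝ) := by positivity
  have l1 := Real.log_le_log h0 e1
  have l2 := Real.log_le_log (h0.trans_le e1) e2
  rw [Nat.cast_pow, Real.log_pow] at l1 l2
  push_cast at l1 l2
  exact ⟨l1, l2⟩

theorem tendsto_log_natCast_atTop : Tendsto (fun k : ℕ => Real.log k) atTop atTop :=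
  Real.tendsto_log_atTop.comp tendsto_natCast_atTop_atTop

theorem eventually_mul_log_le_natCast (c : ℝ) : ∀ᶠ k : ℕ in atTop, c * Real.log k ≤ k := by
  have h := Real.isLittleO_log_id_atTop.comp_tendsto tendsto_natCast_atTop_atTop
  have hc : (0 : ℝ) < (|c| + 1)⁻¹ := by positivity
  filter_upwards [h.bound hc, tendsto_log_natCast_atTop.eventually_ge_atTop 0] with k hk h0
  simp only [Function.comp_apply, id, Real.norm_eq_abs] at hk
  rw [abs_of_nonneg h0, abs_of_nonneg (Nat.cast_nonneg k : (0 : ℝ) ≤ k), inv_mul_eq_div,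
    le_div_iff₀ (by positivity)] at hk
  nlinarith [le_abs_self c]

theorem summable_log_pow_mul_rpow (D : ℕ) {s : ℝ} (hs : s < -1) :
    Summable fun k : ℕ => Real.log k ^ D * (k : ℝ) ^ s := by
  -- The midpoint is still below -1 and leaves a gap r - s > 0 to absorb the logarithms.
  set r := (s + -1) / 2 with hr
  have hr1 : r < -1 := by linarith
  have hsr : 0 < r - s := by linarith
  have hO : (fun x : ℝ => Real.log x ^ D * x ^ s) =O[atTop] fun x => x ^ r := by
    have h1 := (isLittleO_log_rpow_rpow_atTop (D : ℝ) hsr).isBigO.mul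
      (Asymptotics.isBigO_refl (fun x : ℝ => x ^ s) atTop)
    refine h1.congr' ?_ ?_
    · filter_upwards with x
      rw [Real.rpow_natCast]
    · filter_upwards [eventually_gt_atTop 0] with x hx
      rw [← Real.rpow_add hx]
      congr 1
      ring
  exact summable_of_isBigO_nat (Real.summable_nat_rpow.2 hr1)
    (hO.comp_tendsto tendsto_natCast_atTop_atTop)

theorem summable_natCast_mul_half_pow : Summable fun k : ℕ => (k : ℝ) * (1 / 2) ^ k := by
  simpa using summable_pow_mul_geometric_of_norm_lt_one (R := ℝ) 1 (r := 1 / 2)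
    (by rw [Real.norm_eq_abs, abs_of_pos] <;> norm_num)

/-- With N = 2^k, N e^{-B} = (D + 1) e^c ln ln N, so the exponential is of order (ln N)^(-(D+1)e^c),
against B^D ≤ k^D. The resulting exponent is below -1 because e^c > 1. -/
theorem firstMoment_dyadic_le {D : ℕ} {c B : ℝ} (hc : 0 < c) {k : ℕ}
    (hB : B = k * Real.log 2 - Real.log (Real.log (k * Real.log 2)) - Real.log ((D : ℝ) + 1) - c)
    (hk : 1 ≤ Real.log (k * Real.log 2))
    (hB0 : 0 ≤ B) :
    ((2 ^ (k + 1) : ℕ) : ℝ) / (((2 ^ k : ℕ) : ℝ) - 1) * B ^ D *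
        Real.exp (-((((2 ^ k : ℕ) : ℝ) - 1) * Real.exp (-B))) ≤
      4 * Real.exp 1 * Real.log 2 ^ (-((D + 1) * Real.exp c)) *
        (k : ℝ) ^ (D - (D + 1) * Real.exp c) := by
  have hlog2 : 0 < Real.log 2 := Real.log_pos one_lt_two
  have hlog21 : Real.log 2 ≤ 1 := by linarith [Real.log_two_lt_d9]
  have hkpos : (0 : ℝ) < k := by
    rcases Nat.eq_zero_or_pos k with rfl | h
    · norm_num at hk
    · exact_mod_cast h
  have hk1 : (1 : ℝ) ≤ k := by exact_mod_cast (by exact_mod_cast hkpos : 0 < k)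
  set N : ℝ := ((2 ^ k : ℕ) : ℝ) with hN
  have hN0 : 0 < N := by positivity
  have hN2 : 2 ≤ N := by
    rw [hN, Nat.cast_pow]
    calc (2 : ℝ) = ((2 : ℕ) : ℝ) ^ 1 := by norm_num
      _ ≤ _ := pow_le_pow_right₀ (by norm_num) (by exact_mod_cast hk1)
  have hNexp : N = Real.exp (k * Real.log 2) := by
    rw [hN, Real.exp_nat_mul, Real.exp_log two_pos]
    push_cast
    rfl
  set y := Real.log (k * Real.log 2) with hy
  have hBexp : N * Real.exp (-B) = (D + 1) * Real.exp c * y := by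
    have : k * Real.log 2 + -B = Real.log y + Real.log ((D : ℝ) + 1) + c := by rw [hB]; ring
    rw [hNexp, ← Real.exp_add, this, Real.exp_add, Real.exp_add, Real.exp_log (by linarith),
      Real.exp_log (by positivity)]
    ring
  have hBk : B ≤ k := by
    have h1 : 0 ≤ Real.log y := Real.log_nonneg hk
    have h2 : 0 ≤ Real.log ((D : ℝ) + 1) :=
      Real.log_nonneg (by linarith [(Nat.cast_nonneg D : (0 : ℝ) ≤ D)])
    have h3 : (k : ℝ) * Real.log 2 ≤ k := by nlinarith
    rw [hB]
    linarith
  have hfrac : ((2 ^ (k + 1) : ℕ) : ℝ) / (N - 1) ≤ 4 := by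
    have : ((2 ^ (k + 1) : ℕ) : ℝ) = 2 * N := by
      rw [hN]; push_cast; ring
    rw [this, div_le_iff₀ (by linarith)]
    linarith
  have hexp : Real.exp (-((N - 1) * Real.exp (-B))) ≤
      Real.exp 1 * (k * Real.log 2) ^ (-((D + 1) * Real.exp c)) := by
    rw [Real.rpow_def_of_pos (by positivity), ← hy, ← Real.exp_add]
    refine Real.exp_le_exp.2 ?_
    have : Real.exp (-B) ≤ 1 := Real.exp_le_one_iff.2 (by linarith)
    linarith
  calc _ ≤ 4 * (k : ℝ) ^ D * (Real.exp 1 * (k * Real.log 2) ^ (-((D + 1) * Real.exp c))) := by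
        have : 0 ≤ N - 1 := by linarith
        gcongr
    _ = _ := by
        rw [Real.mul_rpow hkpos.le hlog2.le, sub_eq_add_neg (D : ℝ), Real.rpow_add hkpos,
          Real.rpow_natCast]
        ring

/-- A record at a time in block k is among the first 2^(k+1) points and undominated by the first
2^k. The threshold at n is compared with that at 2^k: ln n exceeds k ln 2 by at most ln 2, and the
iterated logarithms only help. -/
theorem measure_frequently_minRecordSum_le_eq_zero {Ω : Type*} [MeasurableSpace Ω] {P : Measure Ω}
    [IsProbabilityMeasure P] {D : ℕ} {X : ℕ → Ω → Fin (D + 1) → ℝ}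
    (hmeas : ∀ i, Measurable (X i)) (hindep : iIndepFun X P)
    (hlaw : ∀ i, P.map (X i) = expLaw (D + 1)) {c : ℝ} (hc : 0 < c) :
    P {ω | ∃ᶠ n : ℕ in atTop, minRecordSum (fun i => X i ω) n ≤
      Real.log n - Real.log (Real.log (Real.log n)) - Real.log ((D : ℝ) + 1) - Real.log 2 - c} =
      0 := by
  have hlog2 : 0 < Real.log 2 := Real.log_pos one_lt_two
  have hexpc : 1 < Real.exp c := Real.one_lt_exp_iff.2 hc
  have hsum := (Real.summable_nat_rpow (p := D - (D + 1) * Real.exp c).2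
    (by nlinarith [(Nat.cast_nonneg D : (0 : ℝ) ≤ D)])).mul_left
    (4 * Real.exp 1 * Real.log 2 ^ (-((D + 1) * Real.exp c)))
  refine measure_frequently_eq_zero_of_dyadic hsum ?_
  have htend : Tendsto (fun k : ℕ => (k : ℝ) * Real.log 2) atTop atTop :=
    tendsto_natCast_atTop_atTop.atTop_mul_const hlog2
  have hB0 : ∀ᶠ k : ℕ in atTop, 0 ≤ k * Real.log 2 - Real.log (Real.log (k * Real.log 2))
      - Real.log ((D : ℝ) + 1) - c := by
    filter_upwards [htend.eventually (Real.isLittleO_log_id_atTop.bound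
        (by norm_num : (0 : ℝ) < 1 / 2)), htend.eventually_ge_atTop 0,
      (Real.tendsto_log_atTop.comp htend).eventually_ge_atTop 1,
      htend.eventually_ge_atTop (2 * (Real.log ((D : ℝ) + 1) + c))] with k h1 h2 h3 h4
    simp only [id, Real.norm_eq_abs, Function.comp_apply] at h1 h3
    have h5 := Real.log_le_sub_one_of_pos (x := Real.log (k * Real.log 2)) (by linarith)
    rw [abs_of_nonneg h2] at h1
    have := le_abs_self (Real.log (k * Real.log 2))
    linarith
  filter_upwards [hB0, (Real.tendsto_log_atTop.comp htend).eventually_ge_atTop 1,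
    eventually_ge_atTop 1] with k hk hk1 hkpos
  simp only [Function.comp_apply] at hk1
  have hkpos' : (0 : ℝ) < k := by exact_mod_cast hkpos
  refine le_trans (measure_mono ?_) ((measure_exists_undominated_le hmeas hindep hlaw hk
    (n₁ := 2 ^ k) (Nat.le_self_pow (by omega) 2) (2 ^ (k + 1))).trans
    (ENNReal.ofReal_le_ofReal (firstMoment_dyadic_le hc rfl hk1 hk)))
  rintro ω ⟨n, hn1, hn2, hle⟩
  obtain ⟨i, hi, hs, hdom⟩ := exists_undominated_of_minRecordSum_le (by omega)
    (Nat.one_le_two_pow.trans hn1) hle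
  refine ⟨i, hi.trans hn2, hs.trans ?_, fun l hl => hdom l (hl.trans_le hn1)⟩
  obtain ⟨l1, l2⟩ := log_bounds_of_dyadic hn1 hn2
  have m1 : Real.log (k * Real.log 2) ≤ Real.log (Real.log n) :=
    Real.log_le_log (by positivity) l1
  have m2 := Real.log_le_log (by linarith) m1
  linarith

-- The mesh h is now fixed, and 2^(k+1) q = g ln k gives e^t = k^g against K^D of order k^D. Powers
-- of ln k do not affect summability, so a single radius serves for both zones.
set_option maxHeartbeats 800000 in
theorem measureReal_not_exists_undominated_dyadic_le {Ω : Type*} [MeasurableSpace Ω] {P : Measure Ω}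
    [IsProbabilityMeasure P] {D : ℕ} (hD : 1 ≤ D) {X : ℕ → Ω → Fin (D + 1) → ℝ}
    (hmeas : ∀ i, Measurable (X i)) (hindep : iIndepFun X P)
    (hlaw : ∀ i, P.map (X i) = expLaw (D + 1)) {g h : ℝ} (hg : 0 < g) (hh : 0 < h) {k : ℕ}
    {q : ℝ} (hq : q = g * Real.log k / 2 ^ (k + 1)) (hlog : 1 ≤ Real.log k)
    (hgk : 32 * (g + 1) * Real.log k ≤ k) (hhk : 4 * h * D ≤ k) :
    P.real {ω | ¬ ∃ i < 2 ^ k, ∑ j, X i ω j ≤ -Real.log q + (D + 1) * h ∧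
        ∀ l < 2 ^ (k + 1), ¬ ∀ j, X i ω j < X l ω j} ≤
      Real.exp 1 * ((4 * h * D) ^ D / (g / 2 * (1 - Real.exp (-h)) ^ (D + 1))
        + 8 * ((6 / h + 3) * (4 * h * D)) ^ D) * (Real.log k ^ D * (k : ℝ) ^ (g - D))
        + 8 * g * (k * (1 / 2) ^ k + (k : ℝ) ^ (-2 : ℝ)) := by
  have hD1 : (1 : ℝ) ≤ D := by exact_mod_cast hD
  set y := Real.log k with hy
  have hy0 : 0 < y := by linarith
  have hk0 : (0 : ℝ) < k := lt_of_lt_of_le (by positivity) hgk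
  have hk32 : (32 : ℝ) ≤ k := by
    have : 1 * 1 ≤ (g + 1) * y := by gcongr; linarith
    linarith
  have hexpy : Real.exp y = k := Real.exp_log hk0
  set N : ℝ := 2 ^ (k + 1) with hN
  have hN0 : 0 < N := by positivity
  have hNk : (k : ℝ) ^ 2 ≤ N := by
    have h1 : ∀ m : ℕ, 4 ≤ m → m ^ 2 ≤ 2 ^ m := fun m hm => by
      induction m, hm using Nat.le_induction with
      | base => norm_num
      | succ m hm ih => rw [pow_succ 2 m]; nlinarith
    have h2 : k ^ 2 ≤ 2 ^ (k + 1) := (h1 k (by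
      have : (4 : ℝ) ≤ k := by linarith
      exact_mod_cast this)).trans (Nat.pow_le_pow_right (by norm_num) (by omega))
    rw [hN]
    exact_mod_cast h2
  set t := g * y with ht
  have ht0 : 0 < t := by positivity
  have htk : 32 * t ≤ k := by linarith
  have hq0 : 0 < q := by rw [hq]; positivity
  have hqk : q ≤ 1 / (32 * k) := by
    rw [hq, div_le_div_iff₀ hN0 (by positivity)]
    have := mul_le_mul_of_nonneg_right htk hk0.le
    linarith
  have hqk' : 1 / (32 * (k : ℝ)) ≤ 1 / 32 := by
    refine one_div_le_one_div_of_le (by norm_num) ?_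
    linarith
  have htq : 6 * t * q ≤ 1 := by
    calc 6 * t * q ≤ 6 * t * (1 / (32 * k)) := by gcongr
      _ = 6 * t / (32 * k) := by ring
      _ ≤ 1 := by rw [div_le_one (by positivity)]; linarith
  have htn : t = ((2 ^ (k + 1) : ℕ) : ℝ) * q := by
    rw [hq, Nat.cast_pow, Nat.cast_ofNat, ← hN]
    field_simp
  have hnq : ((2 ^ k : ℕ) : ℝ) * q = t / 2 := by
    rw [htn, pow_succ]
    push_cast
    ring
  set b := -Real.log q with hb
  have hbk : k / 2 ≤ b := by
    have h1 : Real.log q = Real.log t - (k + 1) * Real.log 2 := by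
      rw [hq, Real.log_div ht0.ne' hN0.ne', hN, Real.log_pow]
      push_cast
      rfl
    have h2 := Real.log_le_sub_one_of_pos ht0
    have h3 := Real.log_two_gt_d9
    have h4 := mul_le_mul_of_nonneg_left h3.le hk0.le
    rw [hb, h1]
    linarith
  have hb0 : 0 < b := by linarith
  set K := ⌊b / (h * D)⌋₊ with hKdef
  have hhD : 0 < h * D := by positivity
  have hKle : (K : ℝ) ≤ b / (h * D) := Nat.floor_le (by positivity)
  have hKge : k / (4 * h * D) ≤ K := by
    have h1 := Nat.lt_floor_add_one (b / (h * D))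
    have h2 : k / 2 / (h * D) ≤ b / (h * D) := by gcongr
    have h3 : 1 ≤ k / (4 * h * D) := by
      rw [le_div_iff₀ (by positivity)]
      linarith
    have h4 : k / 2 / (h * D) = 2 * (k / (4 * h * D)) := by field_simp; ring
    rw [← hKdef] at h1
    linarith
  have hKpos : 0 < k / (4 * h * D) := by positivity
  have hK0 : (0 : ℝ) < K := hKpos.trans_le hKge
  have hKD : h * K * D ≤ b := by
    calc h * K * D ≤ h * (b / (h * D)) * D := by gcongr
      _ = b := by field_simp
  -- Overlap beyond R is at most k^{-3}, so the far error t e^{-h(R+1)} is at most g k^{-2}, which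
  -- is summable.
  set R := ⌈3 * y / h⌉₊ with hR
  have hRl : 3 * y / h ≤ R := Nat.le_ceil _
  have hRu : (2 * R + 1 : ℝ) ≤ (6 / h + 3) * y := by
    have h1 := Nat.ceil_lt_add_one (by positivity : 0 ≤ 3 * y / h)
    rw [← hR] at h1
    have h2 : (6 / h + 3) * y = 2 * (3 * y / h) + 3 * y := by ring
    linarith
  have hfar : Real.exp (-(h * (R + 1))) ≤ ((k : ℝ) ^ 3)⁻¹ := by
    rw [← hexpy, ← Real.exp_nat_mul, ← Real.exp_neg]
    refine Real.exp_le_exp.2 (neg_le_neg ?_)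
    rw [div_le_iff₀ hh] at hRl
    push_cast
    linarith
  have hyk : y ≤ k := by
    have := Real.log_le_sub_one_of_pos hk0
    linarith
  have htfar : t * Real.exp (-(h * (R + 1))) ≤ g * (k : ℝ) ^ (-2 : ℝ) := by
    calc t * Real.exp (-(h * (R + 1))) ≤ g * k * ((k : ℝ) ^ 3)⁻¹ := by
          rw [ht]
          gcongr
      _ = g * (k : ℝ) ^ (-2 : ℝ) := by
          rw [Real.rpow_neg hk0.le, Real.rpow_ofNat]
          field_simp
  have htfar' : t * Real.exp (-(h * (R + 1))) ≤ 1 / 32 := by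
    have h1 : Real.exp (-(h * (R + 1))) ≤ (k : ℝ)⁻¹ := hfar.trans
      (inv_anti₀ hk0 (le_self_pow₀ (by linarith) (by norm_num)))
    calc t * Real.exp (-(h * (R + 1))) ≤ k / 32 * (k : ℝ)⁻¹ := by
          gcongr
          linarith
      _ = 1 / 32 := by field_simp
  have hw : 0 < 1 - Real.exp (-h) := sub_pos.2 (Real.exp_lt_one_iff.2 (by linarith))
  refine (measureReal_not_exists_undominated_le_of_small hmeas hindep hlaw hq0 (by linarith)
    hh (by exact_mod_cast hK0) hKD (Nat.le_self_pow (by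
      rintro rfl
      simp at hk0) 2) (Nat.pow_le_pow_right (by norm_num) (by omega)) R R htn htq
      (by linarith)).trans ?_
  rw [hnq]
  have hexpt : Real.exp (t + 1) = Real.exp 1 * (k : ℝ) ^ g := by
    rw [Real.rpow_def_of_pos hk0, ← Real.exp_add, ht]
    congr 1
    ring
  have hrpow : (k : ℝ) ^ (g - D) = (k : ℝ) ^ g / (k : ℝ) ^ D := by
    rw [Real.rpow_sub hk0, Real.rpow_natCast]
  have hg0 : 0 < (k : ℝ) ^ g := by positivity
  have hT1 : Real.exp (t + 1) / (K ^ D * (t / 2) * (1 - Real.exp (-h)) ^ (D + 1)) ≤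
      Real.exp 1 * ((4 * h * D) ^ D / (g / 2 * (1 - Real.exp (-h)) ^ (D + 1))) *
        (y ^ D * (k : ℝ) ^ (g - D)) := by
    calc _ ≤ Real.exp (t + 1) / ((k / (4 * h * D)) ^ D * (g / 2) *
          (1 - Real.exp (-h)) ^ (D + 1)) := by
          gcongr
          exact le_mul_of_one_le_right hg.le hlog
      _ = Real.exp 1 * ((4 * h * D) ^ D / (g / 2 * (1 - Real.exp (-h)) ^ (D + 1))) *
          (1 * (k : ℝ) ^ (g - D)) := by
          rw [hexpt, hrpow, div_pow]
          field_simp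
      _ ≤ _ := by
          gcongr
          exact one_le_pow₀ hlog
  have hT2 : 4 * ((2 * R + 1) / K) ^ D * Real.exp (t + 1) ≤
      Real.exp 1 * (4 * ((6 / h + 3) * (4 * h * D)) ^ D) * (y ^ D * (k : ℝ) ^ (g - D)) := by
    calc _ ≤ 4 * ((6 / h + 3) * y / (k / (4 * h * D))) ^ D * Real.exp (t + 1) := by gcongr
      _ = _ := by
          have h1 : (6 / h + 3) * y / (k / (4 * h * D)) = (6 / h + 3) * (4 * h * D) * y / k := by
            field_simp
          rw [h1, hexpt, hrpow, div_pow, mul_pow _ y]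
          ring
  have hT3 : 4 * ((2 * R + 1) / K) ^ D * Real.exp ((t + 1) * Real.exp (-(h * (R + 1)))) ≤
      4 * ((2 * R + 1) / K) ^ D * Real.exp (t + 1) := by
    gcongr
    refine mul_le_of_le_one_right (by linarith) (Real.exp_le_one_iff.2 ?_)
    have : 0 ≤ h * (R + 1) := by positivity
    linarith
  have hT4 : q ≤ g * (k * (1 / 2) ^ k) := by
    have h1 : g * (k * (1 / 2) ^ k) = 2 * (g * k) / N := by
      rw [hN, pow_succ, one_div, inv_pow]
      field_simp
    rw [hq, h1]
    gcongr
    have := mul_le_mul_of_nonneg_left hyk hg.le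
    have : 0 ≤ g * k := by positivity
    linarith
  have e1 : Real.exp 1 * ((4 * h * D) ^ D / (g / 2 * (1 - Real.exp (-h)) ^ (D + 1))
      + 8 * ((6 / h + 3) * (4 * h * D)) ^ D) * (y ^ D * (k : ℝ) ^ (g - D)) =
      Real.exp 1 * ((4 * h * D) ^ D / (g / 2 * (1 - Real.exp (-h)) ^ (D + 1))) *
        (y ^ D * (k : ℝ) ^ (g - D)) + 2 * (Real.exp 1 * (4 * ((6 / h + 3) * (4 * h * D)) ^ D) *
        (y ^ D * (k : ℝ) ^ (g - D))) := by ring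
  rw [e1]
  linarith

/-- A point among the first 2^k that is undominated by the first 2^(k+1) is a record throughout
block k, so one such point bounds the minimum at every time of the block. -/
theorem measure_frequently_le_minRecordSum_eq_zero {Ω : Type*} [MeasurableSpace Ω] {P : Measure Ω}
    [IsProbabilityMeasure P] {D : ℕ} (hD : 2 ≤ D) {X : ℕ → Ω → Fin (D + 1) → ℝ}
    (hmeas : ∀ i, Measurable (X i)) (hindep : iIndepFun X P)
    (hlaw : ∀ i, P.map (X i) = expLaw (D + 1)) {c : ℝ} (hc : 0 < c) :
    P {ω | ∃ᶠ n : ℕ in atTop, Real.log n - Real.log (Real.log (Real.log n))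
      - Real.log ((D : ℝ) - 1) + Real.log 2 + c ≤ minRecordSum (fun i => X i ω) n} = 0 := by
  have hlog2 : 0 < Real.log 2 := Real.log_pos one_lt_two
  have hD2 : (2 : ℝ) ≤ D := by exact_mod_cast hD
  have hD1 : 0 < (D : ℝ) - 1 := by linarith
  -- The slack c is divided: c/2 pushes g strictly below D - 1, so that g - D < -1, and c/4 pays for
  -- the box overshoot (D + 1) h.
  set g := ((D : ℝ) - 1) * Real.exp (-(c / 2)) with hg
  have hg0 : 0 < g := by positivity
  have hgD : g < D - 1 := mul_lt_of_lt_one_right hD1 (Real.exp_lt_one_iff.2 (by linarith))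
  set h := c / (4 * (D + 1)) with hh
  have hh0 : 0 < h := by positivity
  have hsum := ((summable_log_pow_mul_rpow D (s := g - D) (by linarith)).mul_left
    (Real.exp 1 * ((4 * h * D) ^ D / (g / 2 * (1 - Real.exp (-h)) ^ (D + 1))
        + 8 * ((6 / h + 3) * (4 * h * D)) ^ D))).add
    ((summable_natCast_mul_half_pow.add
      (Real.summable_nat_rpow.2 (by norm_num : (-2 : ℝ) < -1))).mul_left (8 * g))
  refine measure_frequently_eq_zero_of_dyadic hsum ?_
  filter_upwards [eventually_mul_log_le_natCast (32 * (g + 1)),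
    tendsto_log_natCast_atTop.eventually_ge_atTop 1,
    tendsto_natCast_atTop_atTop.eventually_ge_atTop (4 * h * D),
    eventually_ge_atTop 3] with k h1 h2 h3 h4
  have hbound := measureReal_not_exists_undominated_dyadic_le (by omega : 1 ≤ D) hmeas hindep hlaw
    hg0 hh0 rfl h2 h1 h3
  rw [← ofReal_measureReal]
  refine ENNReal.ofReal_le_ofReal ((measureReal_mono ?_).trans hbound)
  rintro ω ⟨n, hn1, hn2, hle⟩ ⟨i, hi, hs, hdom⟩
  have hmin := minRecordSum_le_of_undominated (x := fun i => X i ω) (Nat.succ_pos D) (hi.trans_le hn1) hs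
    fun l hl => hdom l (hl.trans hn2)
  obtain ⟨l1, l2⟩ := log_bounds_of_dyadic hn1 hn2
  have hk3 : (3 : ℝ) ≤ k := by exact_mod_cast h4
  have hk0 : (0 : ℝ) < k := by linarith
  have hlogn0 : 0 < Real.log n := lt_of_lt_of_le (by positivity) l1
  have hlognk : Real.log n ≤ k := by nlinarith [Real.log_two_lt_d9]
  have m1 : Real.log (Real.log n) ≤ Real.log k := Real.log_le_log hlogn0 hlognk
  have m0 : 0 < Real.log (Real.log n) := by
    refine Real.log_pos ?_
    nlinarith [Real.log_two_gt_d9]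
  have m2 := Real.log_le_log m0 m1
  have hq : Real.log (g * Real.log k / 2 ^ (k + 1)) =
      Real.log ((D : ℝ) - 1) - c / 2 + Real.log (Real.log k) - (k + 1) * Real.log 2 := by
    rw [Real.log_div (by positivity) (by positivity), Real.log_mul hg0.ne' (by linarith), hg,
      Real.log_mul hD1.ne' (Real.exp_pos _).ne', Real.log_exp, Real.log_pow]
    push_cast
    ring
  have hh4 : (D + 1) * h = c / 4 := by rw [hh]; field_simp
  rw [hq, hh4] at hmin
  linarith

/-! ### Tightness and the final statement -/

theorem isBigOInProb_minRecordSum {Ω : Type*} [MeasurableSpace Ω] {P : Measure Ω}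
    [IsProbabilityMeasure P] {D : ℕ} (hD : 1 ≤ D) {X : ℕ → Ω → Fin (D + 1) → ℝ}
    (hmeas : ∀ i, Measurable (X i)) (hindep : iIndepFun X P)
    (hlaw : ∀ i, P.map (X i) = expLaw (D + 1)) :
    IsBigOInProb P
      (fun n ω => minRecordSum (fun i => X i ω) n
        - (Real.log n - Real.log (Real.log (Real.log n)) - Real.log D))
      (fun n => 1 / Real.log (Real.log n)) := by
  intro ε hε
  have hD0 : (0 : ℝ) < D := by exact_mod_cast hD
  have hlim : Tendsto (fun M : ℝ => (2 * Real.exp 1 + overlapConst D) * Real.exp (-M)) atTop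
      (nhds 0) := by
    simpa using Real.tendsto_exp_neg_atTop_nhds_zero.const_mul (2 * Real.exp 1 + overlapConst D)
  obtain ⟨M, hMε, hM⟩ := ((hlim.eventually_le_const (by positivity : (0 : ℝ) < ε / 2)).and
    (eventually_ge_atTop 0)).exists
  -- In the upper tail, replacing l by l - M inside the logarithm costs at most 2M/l, by -ln(1 - u)
  -- ≤ 2u for 0 ≤ u ≤ 1/2, and the box of side 1/l costs (D + 1)/l. The lower tail needs only M/l.
  refine ⟨2 * M + (D + 1), ?_⟩
  have herr := ((tendsto_overlapError hD).comp tendsto_log_log_atTop).eventually_le_const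
    (by positivity : (0 : ℝ) < ε / 2)
  filter_upwards [eventually_mul_log_log_le (3 * D), eventually_mul_log_log_le (8 * D),
    tendsto_log_log_atTop.eventually_ge_atTop 3, tendsto_log_log_atTop.eventually_ge_atTop (2 * M),
    herr, eventually_ge_atTop 2] with n h1 h2 h3 h4 h5 h6
  simp only [Function.comp_apply] at h5
  set l := Real.log (Real.log n) with hl
  have hl0 : 0 < l := by linarith
  have hn0 : (0 : ℝ) < n := by exact_mod_cast (by omega : 0 < n)
  obtain ⟨hb0, hlow⟩ := firstMoment_at_lower_le hD hM (n := n) rfl hl rfl (by linarith)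
    (by linarith) h1
  have hup := measureReal_not_exists_undominated_upper_le hD hmeas hindep hlaw hM (n := n) rfl hl
    h3 h4 h2
  have hfirst := measure_exists_undominated_le hmeas hindep hlaw hb0 h6 n
  have hlogq : -Real.log (D * (l - M) / n) ≤ Real.log n - Real.log l - Real.log D + 2 * (M / l) := by
    have hlM : 0 < l - M := by linarith
    have e1 : l - M = l * (1 - M / l) := by field_simp
    have hu : M / l ≤ 1 / 2 := by rw [div_le_iff₀ hl0]; linarith
    have hu0 : 0 ≤ M / l := by positivity
    have e2 := Real.one_sub_inv_le_log_of_pos (x := 1 - M / l) (by linarith)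
    have e3 : (1 - M / l)⁻¹ ≤ 1 + 2 * (M / l) := by
      rw [inv_le_iff_one_le_mul₀ (by linarith)]
      nlinarith
    rw [Real.log_div (by positivity) hn0.ne', Real.log_mul hD0.ne' hlM.ne', e1,
      Real.log_mul hl0.ne' (by linarith)]
    linarith
  have hsub : {ω | (2 * M + (D + 1)) * |1 / l| < |minRecordSum (fun i => X i ω) n
        - (Real.log n - Real.log l - Real.log D)|} ⊆
      {ω | ∃ i < n, ∑ j, X i ω j ≤ Real.log n - Real.log l - Real.log D - M / l ∧
        ∀ l < n, ¬ ∀ j, X i ω j < X l ω j} ∪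
      {ω | ¬ ∃ i < n, ∑ j, X i ω j ≤ -Real.log (D * (l - M) / n) + (D + 1) * (1 / l) ∧
        ∀ l < n, ¬ ∀ j, X i ω j < X l ω j} := by
    intro ω hω
    rw [Set.mem_ofPred_eq, abs_of_pos (by positivity : 0 < 1 / l), lt_abs] at hω
    have e1 : (2 * M + (D + 1)) * (1 / l) = 2 * (M / l) + (D + 1) * (1 / l) := by ring
    have e2 : 0 ≤ M / l := by positivity
    have e3 : 0 ≤ (D + 1) * (1 / l) := by positivity
    rw [e1] at hω
    rcases hω with hω | hω
    · right
      rintro ⟨i, hi, hs, hdom⟩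
      have := minRecordSum_le_of_undominated (x := fun i => X i ω) (Nat.succ_pos D) hi hs hdom
      linarith
    · left
      exact exists_undominated_of_minRecordSum_le (x := fun i => X i ω) (Nat.succ_pos D) (by omega)
        (by linarith)
  refine (measure_mono hsub).trans ((measure_union_le _ _).trans ?_)
  rw [← ofReal_measureReal (s := {ω | ¬ ∃ i < n, _})]
  refine (add_le_add (hfirst.trans (ENNReal.ofReal_le_ofReal hlow))
    (ENNReal.ofReal_le_ofReal hup)).trans ?_
  have hc : 0 ≤ overlapConst D * Real.exp (-M) + overlapError D l := measureReal_nonneg.trans hup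
  rw [← ENNReal.ofReal_add (by positivity) hc]
  refine ENNReal.ofReal_le_ofReal ?_
  linarith

/-- `X i` is the observation number `i + 1`, and `Real.log^[k]` is the `k`-th iterate of `ln`. -/
theorem theorem1p5 {Ω : Type*} [MeasurableSpace Ω] (P : Measure Ω) [IsProbabilityMeasure P]
    (d : ℕ) (hd : 2 ≤ d) (X : ℕ → Ω → Fin d → ℝ)
    (hmeas : ∀ i, Measurable (X i))
    (hindep : iIndepFun X P)
    (hlaw : ∀ i, P.map (X i) = Measure.pi (fun _ : Fin d => expMeasure 1)) :
    IsBigOInProb P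
      (fun n ω => minRecordSum (fun i => X i ω) n
        - (Real.log (n : ℝ) - Real.log^[3] (n : ℝ) - Real.log ((d : ℝ) - 1)))
      (fun n => 1 / Real.log^[2] (n : ℝ))
    ∧ (3 ≤ d → ∀ c : ℝ, 0 < c →
        P {ω | ∃ᶠ n : ℕ in atTop,
          Real.log (n : ℝ) - Real.log^[3] (n : ℝ) - Real.log ((d : ℝ) - 2) + Real.log 2 + c
            ≤ minRecordSum (fun i => X i ω) n} = 0)
    ∧ (∀ c : ℝ, 0 < c →
        P {ω | ∃ᶠ n : ℕ in atTop,
          minRecordSum (fun i => X i ω) n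
            ≤ Real.log (n : ℝ) - Real.log^[3] (n : ℝ) - Real.log (d : ℝ) - Real.log 2 - c} = 0) := by
  obtain ⟨D, rfl⟩ : ∃ D, d = D + 1 := ⟨d - 1, by omega⟩
  have hD : 1 ≤ D := by omega
  have hlog2 : ∀ x : ℝ, Real.log^[2] x = Real.log (Real.log x) := fun _ => rfl
  have hlog3 : ∀ x : ℝ, Real.log^[3] x = Real.log (Real.log (Real.log x)) := fun _ => rfl
  have h1 : ((D + 1 : ℕ) : ℝ) - 1 = D := by push_cast; ring
  have h2 : ((D + 1 : ℕ) : ℝ) - 2 = (D : ℝ) - 1 := by push_cast; ring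
  have h3 : ((D + 1 : ℕ) : ℝ) = (D : ℝ) + 1 := by push_cast; ring
  refine ⟨?_, fun hd3 c hc => ?_, fun c hc => ?_⟩
  · simp only [hlog2, hlog3, h1]
    exact isBigOInProb_minRecordSum hD hmeas hindep hlaw
  · simp only [hlog3, h2]
    exact measure_frequently_le_minRecordSum_eq_zero (by omega) hmeas hindep hlaw hc
  · simp only [hlog3, h3]
    exact measure_frequently_minRecordSum_le_eq_zero hmeas hindep hlaw hc
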